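/- For partitions $\lambda,\mu,\nu$ write $s_\lambda$ for the Schur function, $\circ$ for the plethystic product and $\langle\,,\rangle$ for the Hall inner product on symmetric functions. Let $$c^\lambda_{\mu,\nu}:=\langle s_\mu s_\nu,s_\lambda\rangle,\qquad a^\mu_{\lambda,\nu}:=\langle s_\lambda\circ s_\nu,s_\mu\rangle$$ be the Littlewood–Richardson coefficients and the plethysm coefficients. For partitions $\alpha,\beta,\gamma,\delta,\nu$ with $|\beta|\le|\alpha|$ and $|\delta|\le|\gamma|$ let $$a^{\alpha/\beta}_{\gamma/\delta,\nu}:=\sum_{\substack{\eta\vdash|\gamma|-|\delta|\\ \zeta\vdash|\alpha|-|\beta|}}c^\gamma_{\eta,\delta}\cdot c^\alpha_{\zeta,\beta}\cdot a^\zeta_{\eta,\nu}$$ (which is $0$ unless $\beta\subseteq\alpha$ and $\delta\subseteq\gamma$), and write $a^{\alpha/\beta}_{\gamma,\nu}:=a^{\alpha/\beta}_{\gamma/\emptyset,\nu}$. For $r\ge 0$, $(r)$ denotes the partition of $r$ with at most one part, so $(0)=\emptyset$; $\lambda'$ is the conjugate of $\lambda$ and $l(\mu)$ the number of parts of $\mu$.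 **Theorem A.** Let $n,m\ge 1$ be integers, $k\in\{0,1,\dots,n-1\}$ and $\lambda\vdash n$. Let $\mu\vdash mn$ with $l(\mu)=n-k$, and let $\hat\mu:=\mu-(1^{n-k})\vdash (m-1)n+k$ be the partition obtained from $\mu$ by lowering each of its parts by one. Then $$a^\mu_{\lambda',(m)}=\sum_{i=0}^{k}(-1)^{k+i}\sum_{\substack{\alpha\vdash k+(m-1)i\\ \beta\vdash i}}a^{\alpha/(k-i)}_{\beta',(m)}\cdot a^{\hat\mu/\alpha}_{\lambda/\beta,(m-1)}.$$ -/

import Mathlib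

noncomputable section

namespace SymFun

/-- The ring `Λ_ℚ` of symmetric functions with rational coefficients, in its standard presentation
`Λ_ℚ = ℚ[p₁, p₂, p₃, …]` as the polynomial ring in the power sums; the variable indexed by `k`
is the power sum `p_k`. -/
abbrev Lambda : Type := MvPolynomial ℕ+ ℚ

/-- A finitely supported `d : ℕ+ →₀ ℕ` encodes the partition with `d k` parts equal to `k`, so that
`MvPolynomial.monomial d 1 = ∏ p_k ^ d k` is the corresponding power-sum product. This is
`z_d = ∏ k ^ d k * (d k)!`. -/
def zed (d : ℕ+ →₀ ℕ) : ℚ :=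
  ∏ k ∈ d.support, ((k : ℕ) : ℚ) ^ d k * ((d k).factorial : ℚ)

/-- The Hall inner product `⟨f, g⟩`: the bilinear form with `⟨p_ρ, p_σ⟩ = δ_{ρσ} z_ρ`. -/
def hall (f g : Lambda) : ℚ :=
  ∑ d ∈ f.support, zed d * (f.coeff d * g.coeff d)

/-- The plethysm `f ∘ g`: the map `f ↦ f ∘ g` is a `ℚ`-algebra homomorphism, and `p_k ∘ g` is
obtained from `g` by replacing each `p_j` by `p_{kj}`. -/
def plethysm (f g : Lambda) : Lambda :=
  MvPolynomial.aeval (fun k : ℕ+ => MvPolynomial.rename (fun j : ℕ+ => k * j) g) f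

/-- The multiplicities of the parts of a partition: `k ↦ #{parts equal to k}`. -/
def mult {n : ℕ} (ρ : n.Partition) : ℕ+ →₀ ℕ :=
  Multiset.toFinsupp (ρ.parts.attach.map fun i => (⟨i.1, ρ.parts_pos i.2⟩ : ℕ+))

/-- The complete homogeneous symmetric function `h_n = ∑_{ρ ⊢ n} z_ρ⁻¹ p_ρ`. -/
def h (n : ℕ) : Lambda :=
  ∑ ρ : n.Partition, MvPolynomial.monomial (mult ρ) (zed (mult ρ))⁻¹

/-- `h_a` for an integer `a`, with `h_a = 0` for `a < 0`. -/
def hInt (a : ℤ) : Lambda := if 0 ≤ a then h a.toNat else 0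

end SymFun

namespace Nat.Partition

/-- The `i`-th part `λ_{i+1}` of a partition `λ₁ ≥ λ₂ ≥ …` (counting from `i = 0`);
it is `0` beyond the length. -/
def row {n : ℕ} (lam : n.Partition) (i : ℕ) : ℕ :=
  (lam.parts.sort (· ≥ ·)).getD i 0

/-- The length `l(λ)`: the number of (nonzero) parts. -/
def length {n : ℕ} (lam : n.Partition) : ℕ := Multiset.card lam.parts

theorem sum_card_filter_lt (s : Multiset ℕ) (n : ℕ) (hs : ∀ a ∈ s, a ≤ n) :
    ((Multiset.range n).map fun j => Multiset.card (s.filter (j < ·))).sum = s.sum := by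
  induction s using Multiset.induction_on with
  | empty => simp
  | cons a s ih =>
    have ha : a ≤ n := hs a (Multiset.mem_cons_self a s)
    have h1 : ∀ j, Multiset.card ((a ::ₘ s).filter (j < ·))
        = (if j < a then 1 else 0) + Multiset.card (s.filter (j < ·)) := by
      intro j
      by_cases hj : j < a
      · simp [hj, add_comm]
      · simp [hj]
    have h2 : ((Multiset.range n).map fun j => if j < a then 1 else 0).sum = a := by
      change ∑ j ∈ Finset.range n, (if j < a then 1 else 0) = a
      rw [← Finset.card_filter]
      have : (Finset.range n).filter (· < a) = Finset.range a := by
        ext j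
        simp
        omega
      rw [this, Finset.card_range]
    rw [Multiset.map_congr rfl (fun j _ => h1 j), Multiset.sum_map_add, h2,
      ih (fun b hb => hs b (Multiset.mem_cons_of_mem hb)), Multiset.sum_cons]

theorem le_of_mem {n : ℕ} (lam : n.Partition) {a : ℕ} (ha : a ∈ lam.parts) : a ≤ n := by
  rw [← lam.parts_sum]
  exact Multiset.single_le_sum (fun _ _ => Nat.zero_le _) a ha

/-- The conjugate partition `λ'`, whose `j`-th part is `#{i : λ_i ≥ j}`. -/
def conjugate {n : ℕ} (lam : n.Partition) : n.Partition :=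
  Nat.Partition.ofSums n
    ((Multiset.range n).map fun j => Multiset.card (lam.parts.filter (j < ·)))
    ((sum_card_filter_lt lam.parts n fun _ ha => le_of_mem lam ha).trans lam.parts_sum)

theorem sum_map_pred (s : Multiset ℕ) (hs : ∀ a ∈ s, 0 < a) :
    (s.map fun a => a - 1).sum = s.sum - Multiset.card s := by
  have key : (s.map fun a => a - 1).sum + Multiset.card s = s.sum := by
    induction s using Multiset.induction_on with
    | empty => simp
    | cons a s ih =>
      have ha := hs a (Multiset.mem_cons_self a s)
      have := ih (fun b hb => hs b (Multiset.mem_cons_of_mem hb))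
      simp only [Multiset.map_cons, Multiset.sum_cons, Multiset.card_cons]
      omega
  omega

/-- The partition `μ - (1^{l(μ)})`: every part is lowered by one (and parts that become zero are
dropped), that is, the first column of the Young diagram is removed. -/
def removeColumn {n : ℕ} (μ : n.Partition) : (n - μ.length).Partition :=
  Nat.Partition.ofSums (n - μ.length) (μ.parts.map fun a => a - 1)
    ((sum_map_pred μ.parts fun _ ha => μ.parts_pos ha).trans (by rw [μ.parts_sum]; rfl))

end Nat.Partition

namespace SymFun

/-- The Schur function, by the Jacobi–Trudi determinant: `s_λ = det (h_{λ_i - i + j})_{1 ≤ i, j ≤ l(λ)}`. -/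
def schur {n : ℕ} (lam : n.Partition) : Lambda :=
  Matrix.det (Matrix.of fun i j : Fin lam.length => hInt ((lam.row i : ℤ) - (i : ℤ) + (j : ℤ)))

/-- The Littlewood–Richardson coefficient `c^λ_{μ,ν} = ⟨s_μ s_ν, s_λ⟩`. -/
def lrCoeff {a b c : ℕ} (lam : a.Partition) (μ : b.Partition) (ν : c.Partition) : ℚ :=
  hall (schur μ * schur ν) (schur lam)

/-- The plethysm coefficient `a^μ_{λ,ν} = ⟨s_λ ∘ s_ν, s_μ⟩`; arguments in the order `μ λ ν`. -/
def plethysmCoeff {a b c : ℕ} (μ : a.Partition) (lam : b.Partition) (ν : c.Partition) : ℚ :=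
  hall (plethysm (schur lam) (schur ν)) (schur μ)

/-- The plethysm coefficient
`a^{α/β}_{γ/δ,ν} = ∑_{η ⊢ |γ|-|δ|, ζ ⊢ |α|-|β|} c^γ_{η,δ} c^α_{ζ,β} a^ζ_{η,ν}` indexed by skew
shapes; arguments in the order `α β γ δ ν`. It is zero if `β ⊄ α` or `δ ⊄ γ`, in accordance with
the convention that skew characters for such pairs vanish. -/
def skewPlethysmCoeff {a b c d e : ℕ} (α : a.Partition) (β : b.Partition)
    (γ : c.Partition) (δ : d.Partition) (ν : e.Partition) : ℚ :=
  ∑ η : (c - d).Partition, ∑ ζ : (a - b).Partition,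
    lrCoeff γ η δ * lrCoeff α ζ β * plethysmCoeff ζ η ν

/-- The partition `(r)` of `r` with at most one part; for `r = 0` this is the empty partition. -/
def oneRow (r : ℕ) : r.Partition := Nat.Partition.indiscrete r

end SymFun

end

/-! The identity computes $\langle g,s_\mu\rangle$ for $g=s_{\lambda'}\circ h_m$ by stripping the
first column off $\mu$. Write $u^\perp$ for the Hall adjoint of multiplication by $u$. Expanding a
Jacobi–Trudi determinant along its first row gives $s_f=\sum_l(-1)^l h_{f_0+l}\,e_l^\perp
s_{(f_1,f_2,\dots)}$. Applying $\omega$ turns the row into a column, and taking adjoints gives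
$\langle g,s_\mu\rangle=\sum_l(-1)^l\langle h_l\,e_{l(\mu)+l}^\perp g,\,s_{\hat\mu}\rangle$
(`hall_jacobiTrudi_column`).

The operators $e_c^\perp$ are the coefficients of the ring homomorphism `oddShift`, which adjoins
one odd variable $t$. Adjoining it sends $h_m$ to $h_m+t\,h_{m-1}$, so $g$ becomes $s_{\lambda'}$
evaluated at $h_m$ plus an odd copy of $h_{m-1}$ (`oddShift_plethysm`). By the coproduct of
$s_{\lambda'}$, with $\omega$ acting on the odd half, the coefficient of $t^{n-i}$ is
$\sum_{\beta,\eta}c^\lambda_{\eta,\beta}\,(s_{\beta'}\circ h_m)(s_\eta\circ h_{m-1})$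
(`coeff_twistedSum_schur`). This vanishes above degree $n$ in $t$, so only $l\le k$ contribute, and
$l=k-i$ gives the outer sum of the theorem. Expanding $h_{k-i}\cdot(s_{\beta'}\circ h_m)$ in Schur
functions $s_\alpha$ produces the two skew plethysm coefficients.

Since Schur functions are defined by determinants and the Hall product by power sums,
orthonormality, $\omega s_{\lambda'}=s_\lambda$ and completeness of the Schur functions are proved
along the way, from the same row and column removal. -/

noncomputable section

namespace SymFun

open MvPolynomial

/-! ### The Hall inner product -/

/-- The weight `∑ k * d k` of an exponent vector, i.e. the size of the encoded partition. -/
abbrev wt : (ℕ+ →₀ ℕ) →+ ℕ := Finsupp.weight (fun k : ℕ+ => (k : ℕ))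

theorem zed_pos (d : ℕ+ →₀ ℕ) : 0 < zed d :=
  Finset.prod_pos fun k _ =>
    mul_pos (pow_pos (by exact_mod_cast k.pos) _) (by exact_mod_cast Nat.factorial_pos _)

theorem zed_ne_zero (d : ℕ+ →₀ ℕ) : zed d ≠ 0 := (zed_pos d).ne'

theorem zed_zero : zed 0 = 1 := by simp [zed]

theorem zed_add_single (d : ℕ+ →₀ ℕ) (k : ℕ+) :
    zed (d + Finsupp.single k 1) = zed d * ((k : ℕ) * (d k + 1)) := by
  classical
  -- The supports of `d` and `d + single k 1` may differ at `k`, so both products are written over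
  -- one index set with the factor at `k` split off.
  have key : ∀ e : ℕ+ →₀ ℕ, e.support ⊆ insert k d.support →
      zed e = ((k : ℕ) : ℚ) ^ e k * ((e k).factorial : ℚ) *
        ∏ j ∈ d.support.erase k, ((j : ℕ) : ℚ) ^ e j * ((e j).factorial : ℚ) := by
    intro e he
    rw [zed, Finset.prod_subset he, ← Finset.mul_prod_erase _ _ (Finset.mem_insert_self k _),
      Finset.erase_insert_eq_erase]
    intro j _ hj
    simp [Finsupp.notMem_support_iff.1 hj]
  rw [key d (Finset.subset_insert _ _), key (d + Finsupp.single k 1)]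
  · have : ∏ j ∈ d.support.erase k, ((j : ℕ) : ℚ) ^ ((d + Finsupp.single k 1 : ℕ+ →₀ ℕ) j) *
        (((d + Finsupp.single k 1 : ℕ+ →₀ ℕ) j).factorial : ℚ) =
        ∏ j ∈ d.support.erase k, ((j : ℕ) : ℚ) ^ d j * ((d j).factorial : ℚ) := by
      refine Finset.prod_congr rfl fun j hj => ?_
      have : j ≠ k := Finset.ne_of_mem_erase hj
      simp [this.symm]
    rw [this]
    simp only [Finsupp.add_apply, Finsupp.single_eq_same, Nat.factorial_succ, pow_succ]
    push_cast
    ring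
  · intro j hj
    by_cases h : j = k
    · simp [h]
    · simp only [Finsupp.mem_support_iff, Finsupp.add_apply, Finsupp.single_apply,
        Ne.symm h, if_false, add_zero] at hj
      simp [h, hj]

theorem hall_eq_sum (f g : Lambda) (s : Finset (ℕ+ →₀ ℕ)) (hs : f.support ⊆ s) :
    hall f g = ∑ d ∈ s, zed d * (f.coeff d * g.coeff d) := by
  rw [hall]
  refine Finset.sum_subset hs fun d _ hd => ?_
  simp [MvPolynomial.notMem_support_iff.1 hd]

theorem hall_comm (f g : Lambda) : hall f g = hall g f := by
  classical
  rw [hall_eq_sum f g _ (Finset.subset_union_left (s₂ := g.support)),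
    hall_eq_sum g f _ (Finset.subset_union_right (s₁ := f.support))]
  exact Finset.sum_congr rfl fun d _ => by ring

theorem hall_add_left (f f' g : Lambda) : hall (f + f') g = hall f g + hall f' g := by
  classical
  rw [hall_eq_sum f g _ (Finset.subset_union_left (s₂ := f'.support)),
    hall_eq_sum f' g _ (Finset.subset_union_right (s₁ := f.support)),
    hall_eq_sum (f + f') g _ MvPolynomial.support_add, ← Finset.sum_add_distrib]
  exact Finset.sum_congr rfl fun d _ => by rw [coeff_add]; ring

theorem hall_smul_left (c : ℚ) (f g : Lambda) : hall (c • f) g = c * hall f g := by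
  rw [hall_eq_sum f g _ subset_rfl, hall_eq_sum (c • f) g _ MvPolynomial.support_smul,
    Finset.mul_sum]
  exact Finset.sum_congr rfl fun d _ => by rw [coeff_smul, smul_eq_mul]; ring

/-- The Hall inner product as a bilinear form. -/
def hallForm : Lambda →ₗ[ℚ] Lambda →ₗ[ℚ] ℚ :=
  LinearMap.mk₂ ℚ hall hall_add_left hall_smul_left
    (fun f g g' => by rw [hall_comm, hall_add_left, hall_comm g, hall_comm g'])
    (fun c f g => by rw [hall_comm, hall_smul_left, hall_comm g, smul_eq_mul])

theorem hall_add_right (f g g' : Lambda) : hall f (g + g') = hall f g + hall f g' :=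
  (hallForm f).map_add g g'

theorem hall_sub_left (f f' g : Lambda) : hall (f - f') g = hall f g - hall f' g :=
  LinearMap.map_sub₂ hallForm f f' g

theorem hall_sub_right (f g g' : Lambda) : hall f (g - g') = hall f g - hall f g' :=
  (hallForm f).map_sub g g'

theorem hall_smul_right (c : ℚ) (f g : Lambda) : hall f (c • g) = c * hall f g :=
  (hallForm f).map_smul c g

theorem hall_zero_left (g : Lambda) : hall 0 g = 0 := LinearMap.map_zero₂ hallForm g

theorem hall_zero_right (f : Lambda) : hall f 0 = 0 := (hallForm f).map_zero

theorem hall_sum_left {ι : Type*} (s : Finset ι) (f : ι → Lambda) (g : Lambda) :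
    hall (∑ i ∈ s, f i) g = ∑ i ∈ s, hall (f i) g := LinearMap.map_sum₂ hallForm s f g

theorem hall_monomial_left (d : ℕ+ →₀ ℕ) (a : ℚ) (g : Lambda) :
    hall (monomial d a) g = zed d * (a * g.coeff d) := by
  classical
  rw [hall_eq_sum _ g {d} MvPolynomial.support_monomial_subset]
  simp

theorem hall_monomial_right (d : ℕ+ →₀ ℕ) (a : ℚ) (g : Lambda) :
    hall g (monomial d a) = zed d * (a * g.coeff d) := by
  rw [hall_comm, hall_monomial_left]

/-- The power-sum products are orthogonal with positive norms $z_d$, so the form is positive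
definite. Identities below are proved by showing that a difference has norm zero. -/
theorem hall_self_eq_zero {f : Lambda} (hf : hall f f = 0) : f = 0 := by
  ext d
  by_contra hd
  have hpos : 0 < hall f f :=
    Finset.sum_pos' (fun e _ => mul_nonneg (zed_pos e).le (mul_self_nonneg _))
      ⟨d, MvPolynomial.mem_support_iff.2 hd, mul_pos (zed_pos d) (mul_self_pos.2 hd)⟩
  exact hpos.ne' hf

theorem eq_of_hall_eq {f g : Lambda} (H : ∀ v, hall f v = hall g v) : f = g := by
  rw [← sub_eq_zero]
  apply hall_self_eq_zero
  rw [hall_sub_left, H, sub_self]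

/-- Multiplication by `p_k` is adjoint to the derivation `k ∂/∂p_k`. -/
theorem hall_X_mul (k : ℕ+) (u v : Lambda) :
    hall (X k * u) v = hall u (((k : ℕ) : ℚ) • pderiv k v) := by
  induction u using MvPolynomial.induction_on' with
  | add p q hp hq => rw [mul_add, hall_add_left, hp, hq, hall_add_left]
  | monomial d a =>
    rw [mul_comm, ← pow_one (X k), ← monomial_add_single, hall_monomial_left, hall_monomial_left,
      zed_add_single, coeff_smul, coeff_pderiv, smul_eq_mul]
    ring

/-! ### Complete homogeneous symmetric functions -/

theorem parts_eq_of_mult {n : ℕ} (ρ : n.Partition) :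
    ρ.parts = (Finsupp.toMultiset (mult ρ)).map PNat.val := by
  unfold mult
  rw [Multiset.toFinsupp_toMultiset]
  refine Eq.trans ?_ (Multiset.map_map PNat.val _ ρ.parts.attach).symm
  exact (Multiset.attach_map_val ρ.parts).symm

theorem sum_toMultiset (d : ℕ+ →₀ ℕ) :
    ((Finsupp.toMultiset d).map PNat.val).sum = wt d := by
  induction d using Finsupp.induction_linear with
  | zero => simp
  | add f g hf hg => rw [map_add, map_add, Multiset.map_add, Multiset.sum_add, hf, hg]
  | single a b => simp [Finsupp.weight_single, Multiset.map_nsmul, Multiset.sum_nsmul]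

theorem wt_mult {n : ℕ} (ρ : n.Partition) : wt (mult ρ) = n := by
  rw [← sum_toMultiset, ← parts_eq_of_mult, ρ.parts_sum]

theorem mult_injective (n : ℕ) : Function.Injective (mult (n := n)) := by
  intro ρ σ hρσ
  apply Nat.Partition.ext
  rw [parts_eq_of_mult, parts_eq_of_mult, hρσ]

theorem exists_mult_eq {n : ℕ} {d : ℕ+ →₀ ℕ} (hd : wt d = n) : ∃ ρ : n.Partition, mult ρ = d := by
  refine ⟨⟨(Finsupp.toMultiset d).map PNat.val, ?_, ?_⟩, ?_⟩
  · intro i hi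
    obtain ⟨k, -, rfl⟩ := Multiset.mem_map.1 hi
    exact k.pos
  · rw [sum_toMultiset, hd]
  · apply (Multiset.toFinsupp (α := ℕ+)).symm.injective
    apply Multiset.map_injective PNat.coe_injective
    exact (parts_eq_of_mult _).symm

theorem coeff_h (n : ℕ) (d : ℕ+ →₀ ℕ) : (h n).coeff d = if wt d = n then (zed d)⁻¹ else 0 := by
  classical
  rw [h, coeff_sum]
  simp only [coeff_monomial]
  split_ifs with hd
  · obtain ⟨ρ, rfl⟩ := exists_mult_eq hd
    rw [Finset.sum_eq_single ρ]
    · simp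
    · intro σ _ hσ
      rw [if_neg fun H => hσ (mult_injective n H)]
    · simp
  · refine Finset.sum_eq_zero fun ρ _ => if_neg ?_
    rintro rfl
    exact hd (wt_mult ρ)

theorem h_zero : h 0 = 1 := by
  classical
  ext d
  rw [coeff_h, coeff_one]
  have : wt d = 0 ↔ 0 = d := by
    constructor
    · intro h0
      ext k
      by_contra hk
      have := Finsupp.le_weight_of_ne_zero' (fun k : ℕ+ => (k : ℕ)) (Ne.symm hk)
      rw [h0] at this
      exact absurd this (by simp)
    · rintro rfl
      exact map_zero _
  simp only [this]
  split_ifs with hd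
  · rw [← hd, zed_zero, inv_one]
  · rfl

theorem wt_add_single (d : ℕ+ →₀ ℕ) (k : ℕ+) : wt (d + Finsupp.single k 1) = wt d + k := by
  rw [map_add, wt, Finsupp.weight_single]; simp

/-- This is $p_k^\perp h_n=h_{n-k}$: the factor $k(d_k+1)$ from differentiating cancels the growth
of $z_d$ when a part $k$ is added. -/
theorem smul_pderiv_h (n : ℕ) (k : ℕ+) :
    ((k : ℕ) : ℚ) • pderiv k (h n) = if (k : ℕ) ≤ n then h (n - k) else 0 := by
  ext d
  rw [coeff_smul, coeff_pderiv, coeff_h, wt_add_single, zed_add_single, smul_eq_mul]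
  have hk : ((k : ℕ) : ℚ) ≠ 0 := by exact_mod_cast k.pos.ne'
  have hz := zed_ne_zero d
  have hd : (d k : ℚ) + 1 ≠ 0 := by positivity
  by_cases hkn : (k : ℕ) ≤ n
  · rw [if_pos hkn, coeff_h]
    by_cases hw : wt d + k = n
    · rw [if_pos hw, if_pos (by omega)]
      field_simp
    · rw [if_neg hw, if_neg (by omega)]
      simp
  · rw [if_neg hkn, if_neg (by omega)]
    simp

/-- Newton's identity. -/
theorem newton (n : ℕ) :
    ((n + 1 : ℕ) : ℚ) • h (n + 1) = ∑ i ∈ Finset.range (n + 1), X i.succPNat * h (n - i) := by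
  classical
  ext d
  have hz := zed_ne_zero d
  rw [coeff_smul, coeff_sum, coeff_h, smul_eq_mul]
  -- Removing one part of size $i+1$ divides $z_d$ by $(i+1)d_{i+1}$. Summing these factors over $i$
  -- recovers the weight $n+1$.
  have key : ∀ i ∈ Finset.range (n + 1), coeff d (X i.succPNat * h (n - i)) =
      if wt d = n + 1 then ((i + 1 : ℕ) : ℚ) * d i.succPNat * (zed d)⁻¹ else 0 := by
    intro i hi
    have hi' : i < n + 1 := Finset.mem_range.1 hi
    rw [coeff_X_mul', coeff_h]
    by_cases hs : i.succPNat ∈ d.support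
    · obtain ⟨e, rfl⟩ : ∃ e, d = e + Finsupp.single i.succPNat 1 :=
        ⟨d - Finsupp.single i.succPNat 1, (tsub_add_cancel_of_le (by
          rw [Finsupp.single_le_iff]
          exact Nat.one_le_iff_ne_zero.2 (Finsupp.mem_support_iff.1 hs))).symm⟩
      rw [if_pos hs, add_tsub_cancel_right, wt_add_single, zed_add_single, Nat.succPNat_coe]
      have hze := zed_ne_zero e
      by_cases hw : wt e = n - i
      · rw [if_pos hw, if_pos (by omega)]
        simp only [Finsupp.add_apply, Finsupp.single_eq_same]
        have : (e i.succPNat : ℚ) + 1 ≠ 0 := by positivity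
        have : (i : ℚ) + 1 ≠ 0 := by positivity
        push_cast
        field_simp
      · rw [if_neg hw, if_neg (by omega)]
    · rw [if_neg hs, Finsupp.notMem_support_iff.1 hs]
      simp
  rw [Finset.sum_congr rfl key]
  by_cases hw : wt d = n + 1
  · simp only [if_pos hw]
    rw [← Finset.sum_mul]
    congr 1
    have hsum : (∑ i ∈ Finset.range (n + 1), (i + 1) * d i.succPNat) = n + 1 := by
      have hsub : d.support ⊆ (Finset.range (n + 1)).map ⟨Nat.succPNat, Nat.succPNat_injective⟩ := by
        intro k hk
        have : (k : ℕ) ≤ wt d := 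
          Finsupp.le_weight_of_ne_zero' (fun k : ℕ+ => (k : ℕ)) (Finsupp.mem_support_iff.1 hk)
        simp only [Finset.mem_map, Finset.mem_range, Function.Embedding.coeFn_mk]
        exact ⟨k.natPred, by have := k.natPred_add_one; omega, PNat.succPNat_natPred k⟩
      conv_rhs => rw [← hw]
      rw [wt, Finsupp.weight_apply, Finsupp.sum, Finset.sum_subset hsub, Finset.sum_map]
      · refine Finset.sum_congr rfl fun i _ => ?_
        simp [mul_comm]
      · intro k _ hk
        simp [Finsupp.notMem_support_iff.1 hk]
    exact_mod_cast hsum.symm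
  · simp [if_neg hw]

end SymFun

namespace SymFun

open MvPolynomial

/-! ### The involution `ω` -/

/-- The sign `(-1)^(k-1)` by which `ω` acts on `p_k`. -/
def sgn (k : ℕ+) : ℚ := (-1) ^ ((k : ℕ) + 1)

theorem sgn_mul_self (k : ℕ+) : sgn k * sgn k = 1 := by
  rw [sgn, ← mul_pow]; simp

/-- The sign by which `ω` acts on a power-sum product. -/
def sgnMon (d : ℕ+ →₀ ℕ) : ℚ := d.prod fun k c => sgn k ^ c

theorem sgnMon_mul_self (d : ℕ+ →₀ ℕ) : sgnMon d * sgnMon d = 1 := by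
  rw [sgnMon, Finsupp.prod, ← Finset.prod_mul_distrib]
  exact Finset.prod_eq_one fun k _ => by rw [← mul_pow, sgn_mul_self, one_pow]

/-- The involution `ω` of the ring of symmetric functions. -/
def omega : Lambda →ₐ[ℚ] Lambda := aeval fun k => sgn k • X k

theorem omega_X (k : ℕ+) : omega (X k) = sgn k • X k := aeval_X _ _

theorem omega_monomial (d : ℕ+ →₀ ℕ) (a : ℚ) :
    omega (monomial d a) = monomial d (sgnMon d * a) := by
  rw [omega, aeval_monomial, monomial_eq, sgnMon, Finsupp.prod, Finsupp.prod, Finsupp.prod]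
  simp only [smul_eq_C_mul, mul_pow, map_mul, map_prod, map_pow, algebraMap_eq]
  rw [Finset.prod_mul_distrib]
  ring

theorem coeff_omega (f : Lambda) (d : ℕ+ →₀ ℕ) : (omega f).coeff d = sgnMon d * f.coeff d := by
  classical
  induction f using MvPolynomial.induction_on' with
  | add p q hp hq => rw [map_add, coeff_add, hp, hq, coeff_add, mul_add]
  | monomial e a =>
    rw [omega_monomial, coeff_monomial, coeff_monomial]
    split_ifs with h
    · rw [h]
    · simp

theorem omega_omega (f : Lambda) : omega (omega f) = f := by
  ext d
  rw [coeff_omega, coeff_omega, ← mul_assoc, sgnMon_mul_self, one_mul]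

theorem hall_omega_left (f g : Lambda) : hall (omega f) g = hall f (omega g) := by
  induction f using MvPolynomial.induction_on' with
  | add p q hp hq => rw [map_add, hall_add_left, hp, hq, hall_add_left]
  | monomial e a =>
    rw [omega_monomial, hall_monomial_left, hall_monomial_left, coeff_omega]
    ring

theorem hall_omega_omega (f g : Lambda) : hall (omega f) (omega g) = hall f g := by
  rw [hall_omega_left, omega_omega]

/-- The elementary symmetric functions. -/
def e (n : ℕ) : Lambda := omega (h n)

/-! ### Adding one variable -/

section AddVariable

variable {R : Type*} [CommRing R] [Algebra ℚ R]

theorem newton_map (φ : Lambda →ₐ[ℚ] R) (n : ℕ) :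
    ((n + 1 : ℕ) : R) * φ (h (n + 1)) =
      ∑ i ∈ Finset.range (n + 1), φ (X i.succPNat) * φ (h (n - i)) := by
  have := congrArg φ (newton n)
  rw [map_smul, map_sum, Algebra.smul_def, map_natCast] at this
  rw [this]
  exact Finset.sum_congr rfl fun i _ => map_mul _ _ _

/-- The effect on `h_n` of adding an odd variable `T`. -/
theorem map_h_succ_of_add_odd (φ ψ : Lambda →ₐ[ℚ] R) (T : R)
    (H : ∀ k : ℕ+, ψ (X k) = φ (X k) - (-T) ^ (k : ℕ)) (n : ℕ) :
    ψ (h (n + 1)) = φ (h (n + 1)) + T * φ (h n) := by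
  induction n using Nat.strong_induction_on with
  | _ n ih =>
    have hunit : IsUnit ((n + 1 : ℕ) : R) := by
      have : ((n + 1 : ℕ) : R) = algebraMap ℚ R ((n + 1 : ℕ) : ℚ) := (map_natCast _ _).symm
      rw [this]
      exact (IsUnit.mk0 _ (by positivity)).map (algebraMap ℚ R)
    have h1 : ∀ i ∈ Finset.range (n + 1), ψ (h (n - i)) =
        φ (h (n - i)) + if i < n then T * φ (h (n - i - 1)) else 0 := by
      intro i hi
      by_cases hin : i < n
      · obtain ⟨j, hj⟩ : ∃ j, n - i = j + 1 := ⟨n - i - 1, by omega⟩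
        rw [if_pos hin, hj, ih j (by omega)]
        simp
      · have : n - i = 0 := by omega
        rw [if_neg hin, this, h_zero, map_one, map_one, add_zero]
    -- The powers of $T$ enter Newton's sum through $\psi(p_{i+1})$ and, by induction, through
    -- $\psi(h_{n-i})$; their products telescope.
    have tel : ∀ N ≤ n, ∑ i ∈ Finset.range N,
        ((-T) ^ (i + 1) * φ (h (n - i)) - (-T) ^ (i + 1) * (-T) * φ (h (n - i - 1))) =
        (-T) * φ (h n) - (-T) ^ (N + 1) * φ (h (n - N)) := by
      intro N hN
      induction N with
      | zero => simp
      | succ N ihN =>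
        rw [Finset.sum_range_succ, ihN (by omega), Nat.sub_sub]
        ring
    -- After multiplication by $n+1$, Newton's identity applies to both homomorphisms. The inductive
    -- terms give $nT\varphi(h_n)$, and the telescoping sum supplies the remaining $T\varphi(h_n)$.
    apply hunit.mul_left_cancel
    rw [newton_map, mul_add, newton_map]
    have h2 : ∀ i ∈ Finset.range (n + 1), ψ (X i.succPNat) * ψ (h (n - i)) =
        φ (X i.succPNat) * φ (h (n - i)) +
        (if i < n then T * (φ (X i.succPNat) * φ (h (n - 1 - i))) else 0) -
        ((-T) ^ (i + 1) * φ (h (n - i)) -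
          if i < n then (-T) ^ (i + 1) * (-T) * φ (h (n - i - 1)) else 0) := by
      intro i hi
      rw [h1 i hi, H, Nat.succPNat_coe, Nat.succ_eq_add_one, Nat.sub_right_comm]
      split_ifs <;> ring
    rw [Finset.sum_congr rfl h2, Finset.sum_sub_distrib, Finset.sum_add_distrib, add_sub_assoc]
    congr 1
    have h3 : ∑ i ∈ Finset.range (n + 1),
        (if i < n then T * (φ (X i.succPNat) * φ (h (n - 1 - i))) else 0) =
        T * (n * φ (h n)) := by
      rw [Finset.sum_range_succ, if_neg (lt_irrefl n), add_zero]
      cases n with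
      | zero => simp
      | succ n =>
        rw [newton_map, Finset.mul_sum]
        refine Finset.sum_congr rfl fun i hi => ?_
        rw [if_pos (Finset.mem_range.1 hi)]
        simp
    have h4 : ∑ i ∈ Finset.range (n + 1), ((-T) ^ (i + 1) * φ (h (n - i)) -
          if i < n then (-T) ^ (i + 1) * (-T) * φ (h (n - i - 1)) else 0) = -T * φ (h n) := by
      rw [Finset.sum_range_succ, if_neg (lt_irrefl n)]
      have : ∀ i ∈ Finset.range n, ((-T) ^ (i + 1) * φ (h (n - i)) -
          if i < n then (-T) ^ (i + 1) * (-T) * φ (h (n - i - 1)) else 0) =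
          ((-T) ^ (i + 1) * φ (h (n - i)) - (-T) ^ (i + 1) * (-T) * φ (h (n - i - 1))) := by
        intro i hi
        rw [if_pos (Finset.mem_range.1 hi)]
      rw [Finset.sum_congr rfl this, tel n le_rfl]
      simp
    rw [h3, h4]
    push_cast
    ring

theorem map_hInt_of_add_odd (φ ψ : Lambda →ₐ[ℚ] R) (T : R)
    (H : ∀ k : ℕ+, ψ (X k) = φ (X k) - (-T) ^ (k : ℕ)) (a : ℤ) :
    ψ (hInt a) = φ (hInt a) + T * φ (hInt (a - 1)) := by
  rcases lt_trichotomy a 0 with ha | rfl | ha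
  · rw [hInt, hInt, if_neg (by omega), if_neg (by omega)]
    simp
  · simp [hInt, h_zero]
  · obtain ⟨n, rfl⟩ : ∃ n : ℕ, a = n + 1 := ⟨(a - 1).toNat, by omega⟩
    have h1 : hInt ((n : ℤ) + 1) = h (n + 1) := by
      rw [hInt, if_pos (by omega)]
      congr 1
    have h2 : hInt ((n : ℤ) + 1 - 1) = h n := by
      rw [hInt, if_pos (by omega)]
      congr 1
      omega
    rw [h1, h2, map_h_succ_of_add_odd φ ψ T H]

end AddVariable

theorem hInt_natCast (n : ℕ) : hInt n = h n := by simp [hInt]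

theorem hInt_of_neg {a : ℤ} (ha : a < 0) : hInt a = 0 := if_neg (by omega)

/-! ### The operators adjoint to multiplication by `h_c` and `e_c` -/

/-- The homomorphism `p_k ↦ p_k + t^k`; its coefficients are the adjoints `h_c^⊥`. -/
def evenShift : Lambda →ₐ[ℚ] Polynomial Lambda :=
  aeval fun k => Polynomial.C (X k) + Polynomial.X ^ (k : ℕ)

/-- The homomorphism `p_k ↦ p_k + (-1)^(k-1) t^k`; its coefficients are the adjoints `e_c^⊥`. -/
def oddShift : Lambda →ₐ[ℚ] Polynomial Lambda :=
  aeval fun k => Polynomial.C (X k) - (-Polynomial.X) ^ (k : ℕ)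

theorem evenShift_X (k : ℕ+) :
    evenShift (X k) = Polynomial.C (X k) + Polynomial.X ^ (k : ℕ) := aeval_X _ _

theorem oddShift_X (k : ℕ+) :
    oddShift (X k) = Polynomial.C (X k) - (-Polynomial.X) ^ (k : ℕ) := aeval_X _ _

/-- The inclusion of constant polynomials. -/
abbrev constHom : Lambda →ₐ[ℚ] Polynomial Lambda :=
  IsScalarTower.toAlgHom ℚ Lambda (Polynomial Lambda)

theorem constHom_apply (f : Lambda) : constHom f = Polynomial.C f := rfl

theorem evenShift_hInt (a : ℤ) :
    evenShift (hInt a) = Polynomial.C (hInt a) + Polynomial.X * evenShift (hInt (a - 1)) := by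
  -- Adding the odd variable $-t$ undoes adding the even variable $t$, so the constant embedding
  -- plays the role of $\psi$.
  have := map_hInt_of_add_odd evenShift constHom (-Polynomial.X)
    (fun k => by rw [evenShift_X, neg_neg, constHom_apply]; ring) a
  rw [← constHom_apply, this]
  ring

theorem oddShift_hInt (a : ℤ) :
    oddShift (hInt a) = Polynomial.C (hInt a) + Polynomial.X * Polynomial.C (hInt (a - 1)) :=
  map_hInt_of_add_odd constHom oddShift Polynomial.X
    (fun k => by rw [oddShift_X]; rfl) a

theorem coeff_evenShift_hInt (c : ℕ) (a : ℤ) : (evenShift (hInt a)).coeff c = hInt (a - c) := by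
  induction c generalizing a with
  | zero => rw [evenShift_hInt]; simp
  | succ c ih =>
    rw [evenShift_hInt, Polynomial.coeff_add, Polynomial.coeff_C_succ, zero_add,
      Polynomial.coeff_X_mul, ih]
    congr 1
    push_cast
    ring

theorem smul_pderiv_h_mul (c : ℕ) (k : ℕ+) (v : Lambda) :
    ((k : ℕ) : ℚ) • pderiv k (h c * v) =
      h c * (((k : ℕ) : ℚ) • pderiv k v) + if (k : ℕ) ≤ c then h (c - k) * v else 0 := by
  have h1 := smul_pderiv_h c k
  rw [Derivation.leibniz, smul_add, smul_eq_mul, smul_eq_mul, mul_smul_comm, mul_comm v,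
    ← smul_mul_assoc _ (pderiv k (h c)) v, h1]
  split_ifs <;> simp

/-- Induction on `g`, one factor $p_k$ at a time. The adjoint $k\,\partial/\partial p_k$ sends
$h_cv$ to $h_c(k\,\partial v/\partial p_k)+h_{c-k}v$, matching the two summands of $p_k+t^k$. -/
theorem hall_coeff_evenShift (c : ℕ) (g v : Lambda) :
    hall ((evenShift g).coeff c) v = hall g (h c * v) := by
  induction g using MvPolynomial.induction_on generalizing c v with
  | C a =>
    have h1 : evenShift (C a) = Polynomial.C (C a) := by
      rw [← algebraMap_eq, AlgHom.commutes]
      rfl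
    rw [h1, Polynomial.coeff_C]
    have h2 : ∀ w : Lambda, hall (C a) w = a * w.coeff 0 := fun w => by
      rw [C_apply, hall_monomial_left, zed_zero, one_mul]
    split_ifs with hc
    · rw [hc, h_zero, one_mul]
    · have h3 : (h c).coeff 0 = 0 := by rw [coeff_h, if_neg (by simpa using Ne.symm hc)]
      have h4 : (h c * v).coeff 0 = (h c).coeff 0 * v.coeff 0 :=
        map_mul (constantCoeff (σ := ℕ+) (R := ℚ)) _ _
      rw [h2, h4, h3, hall_zero_left]
      simp
  | add p q hp hq =>
    rw [map_add, Polynomial.coeff_add, hall_add_left, hp, hq, hall_add_left]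
  | mul_X p k ih =>
    rw [map_mul, evenShift_X, mul_add, Polynomial.coeff_add, Polynomial.coeff_mul_C,
      Polynomial.coeff_mul_X_pow', hall_add_left, mul_comm, hall_X_mul, ih, mul_comm p,
      hall_X_mul, smul_pderiv_h_mul, hall_add_right]
    congr 1
    split_ifs
    · rw [ih]
    · rw [hall_zero_left, hall_zero_right]

/-- On generators, the sign of $\omega$ turns $(-t)^k$ into $-t^k$: $\omega$ exchanges even and odd
variables. -/
theorem oddShift_omega (g : Lambda) :
    oddShift (omega g) = (evenShift g).map (omega : Lambda →+* Lambda) := by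
  have : oddShift.comp omega = ((Polynomial.mapAlgHom omega).comp evenShift) := by
    apply MvPolynomial.algHom_ext
    intro k
    rw [AlgHom.comp_apply, AlgHom.comp_apply, omega_X, map_smul, oddShift_X, evenShift_X]
    simp only [Polynomial.coe_mapAlgHom, Polynomial.map_add, Polynomial.map_C,
      Polynomial.map_pow, Polynomial.map_X]
    have h1 : ((omega : Lambda →+* Lambda) : Lambda → Lambda) (X k) = sgn k • X k := omega_X k
    have h2 : sgn k • (-Polynomial.X : Polynomial Lambda) ^ (k : ℕ) =
        - Polynomial.X ^ (k : ℕ) := by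
      rw [neg_pow (Polynomial.X : Polynomial Lambda) (k : ℕ), sgn, pow_succ, Algebra.smul_def, ← mul_assoc]
      simp only [map_mul, map_pow, map_neg, map_one]
      rcases neg_one_pow_eq_or (Polynomial Lambda) (k : ℕ) with h | h <;> rw [h] <;> ring
    rw [smul_sub, h2, sub_neg_eq_add, Polynomial.smul_C]
    exact congrArg (fun x => Polynomial.C x + _) h1.symm
  exact DFunLike.congr_fun this g

theorem evenShift_omega (g : Lambda) :
    evenShift (omega g) = (oddShift g).map (omega : Lambda →+* Lambda) := by
  have := oddShift_omega (omega g)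
  rw [omega_omega] at this
  rw [this, Polynomial.map_map]
  have : ((omega : Lambda →+* Lambda).comp (omega : Lambda →+* Lambda)) = RingHom.id _ :=
    RingHom.ext omega_omega
  rw [this, Polynomial.map_id]

theorem hall_coeff_oddShift (c : ℕ) (g v : Lambda) :
    hall ((oddShift g).coeff c) v = hall g (e c * v) := by
  have h1 := oddShift_omega (omega g)
  rw [omega_omega] at h1
  rw [h1, Polynomial.coeff_map]
  change hall (omega _) v = _
  rw [hall_omega_left, hall_coeff_evenShift, hall_omega_left, map_mul, omega_omega]
  rfl

end SymFun

namespace SymFun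

open MvPolynomial

/-! ### Jacobi–Trudi determinants of sequences -/

/-- The Jacobi–Trudi determinant of the first `r` terms of a sequence. -/
def jacobiTrudi (r : ℕ) (f : ℕ → ℕ) : Lambda :=
  Matrix.det (Matrix.of fun i j : Fin r => hInt ((f i : ℤ) - (i : ℤ) + (j : ℤ)))

theorem jacobiTrudi_zero (f : ℕ → ℕ) : jacobiTrudi 0 f = 1 := Matrix.det_fin_zero

/-- The last row is $(0,\dots,0,1)$, because $h_a=0$ for $a<0$. -/
theorem jacobiTrudi_succ_of_eq_zero {r : ℕ} {f : ℕ → ℕ} (hf : f r = 0) :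
    jacobiTrudi (r + 1) f = jacobiTrudi r f := by
  rw [jacobiTrudi, Matrix.det_succ_row _ (Fin.last r), Finset.sum_eq_single (Fin.last r)]
  · rw [jacobiTrudi]
    simp only [Matrix.of_apply, Fin.val_last, hf]
    have : hInt (((0 : ℕ) : ℤ) - (r : ℤ) + (r : ℤ)) = 1 := by
      rw [← h_zero, ← hInt_natCast]; congr 1; ring
    rw [this, Even.neg_one_pow ⟨r, rfl⟩, one_mul, one_mul]
    congr 1
    ext i j : 2
    simp [Fin.succAbove_last]
  · intro j _ hj
    have : (j : ℕ) < r := by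
      have := Fin.lt_last_iff_ne_last.2 hj
      simpa [Fin.lt_def] using this
    simp only [Matrix.of_apply, Fin.val_last, hf]
    rw [hInt_of_neg (by omega)]
    simp
  · simp

theorem jacobiTrudi_eq_of_le {r s : ℕ} {f : ℕ → ℕ} (hrs : r ≤ s) (hf : ∀ i, r ≤ i → f i = 0) :
    jacobiTrudi s f = jacobiTrudi r f := by
  induction s, hrs using Nat.le_induction with
  | base => rfl
  | succ n hn ih => rw [jacobiTrudi_succ_of_eq_zero (hf n hn), ih]

/-- Subtracting $t$ times the preceding column makes every column but the first free of $t$;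
expansion along the first column then isolates the powers of $t$. -/
theorem coeff_evenShift_jacobiTrudi (r c : ℕ) (f : ℕ → ℕ) :
    (evenShift (jacobiTrudi (r + 1) f)).coeff c =
      ∑ i : Fin (r + 1), (-1) ^ (i : ℕ) * hInt ((f i : ℤ) - (i : ℤ) - (c : ℤ)) *
        Matrix.det (Matrix.of fun a b : Fin r =>
          hInt ((f (i.succAbove a) : ℤ) - (i.succAbove a : ℤ) + (b.succ : ℤ))) := by
  have hdet : evenShift (jacobiTrudi (r + 1) f) = Matrix.det (Matrix.of fun i j : Fin (r + 1) =>
      (Fin.cases (evenShift (hInt ((f i : ℤ) - (i : ℤ))))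
        (fun b => Polynomial.C (hInt ((f i : ℤ) - (i : ℤ) + (b.succ : ℤ)))) j :
        Polynomial Lambda)) := by
    rw [jacobiTrudi, AlgHom.map_det]
    apply Matrix.det_eq_of_forall_col_eq_smul_add_pred (fun _ => Polynomial.X)
    · intro i
      simp
    · intro i j
      simp only [AlgHom.mapMatrix_apply, Matrix.map_apply, Matrix.of_apply, Fin.cases_succ]
      rw [evenShift_hInt]
      congr 4
      simp only [Fin.val_succ, Fin.val_castSucc]
      push_cast
      ring
  rw [hdet, Matrix.det_succ_column_zero, Polynomial.finsetSum_coeff]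
  refine Finset.sum_congr rfl fun i _ => ?_
  have hminor : (Matrix.of fun i j : Fin (r + 1) =>
      (Fin.cases (evenShift (hInt ((f i : ℤ) - (i : ℤ))))
        (fun b => Polynomial.C (hInt ((f i : ℤ) - (i : ℤ) + (b.succ : ℤ)))) j :
        Polynomial Lambda)).submatrix i.succAbove Fin.succ =
      (Polynomial.C : Lambda →+* Polynomial Lambda).mapMatrix (Matrix.of fun a b : Fin r =>
          hInt ((f (i.succAbove a) : ℤ) - (i.succAbove a : ℤ) + (b.succ : ℤ))) := by
    ext a b : 2
    simp
  rw [hminor, ← RingHom.map_det, Polynomial.coeff_mul_C]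
  have : ((-1 : Polynomial Lambda)) ^ (i : ℕ) = Polynomial.C ((-1) ^ (i : ℕ)) := by simp
  rw [this, Polynomial.coeff_C_mul]
  simp only [Matrix.of_apply, Fin.cases_zero]
  rw [coeff_evenShift_hInt]

theorem coeff_evenShift_jacobiTrudi_eq_zero {r c : ℕ} {f : ℕ → ℕ} (hf : Antitone f)
    (hc : f 0 < c) : (evenShift (jacobiTrudi r f)).coeff c = 0 := by
  cases r with
  | zero =>
    rw [jacobiTrudi_zero, map_one, Polynomial.coeff_one, if_neg (by omega)]
  | succ r =>
    rw [coeff_evenShift_jacobiTrudi]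
    refine Finset.sum_eq_zero fun i _ => ?_
    have := hf (Nat.zero_le i)
    rw [hInt_of_neg (by omega)]
    simp

/-- In the column expansion every index below the first row is negative, so $h_{f_0}^\perp$ simply
deletes the first row. -/
theorem coeff_evenShift_jacobiTrudi_top {r : ℕ} {f : ℕ → ℕ} (hf : Antitone f) :
    (evenShift (jacobiTrudi (r + 1) f)).coeff (f 0) = jacobiTrudi r (fun i => f (i + 1)) := by
  rw [coeff_evenShift_jacobiTrudi, Finset.sum_eq_single 0]
  · rw [jacobiTrudi]
    have : hInt ((f (0 : Fin (r + 1)) : ℤ) - ((0 : Fin (r + 1)) : ℤ) - (f 0 : ℤ)) = 1 := by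
      rw [← h_zero, ← hInt_natCast]; congr 1; simp
    rw [this]
    simp only [Fin.val_zero, pow_zero, one_mul]
    congr 1
    ext i j : 2
    simp only [Matrix.of_apply, Fin.succAbove_zero, Fin.val_succ]
    congr 1
    push_cast
    ring_nf
  · intro i _ hi
    have := hf (Nat.zero_le i)
    have : (i : ℕ) ≠ 0 := fun h => hi (Fin.ext h)
    rw [hInt_of_neg (by omega)]
    simp
  · simp

/-- As a determinant of a matrix linear in $t$, it has degree at most $r$, and its top coefficient
can be read off: $e_r^\perp$ removes a full column from $r$ positive rows. -/
theorem oddShift_jacobiTrudi (r : ℕ) (f : ℕ → ℕ) :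
    oddShift (jacobiTrudi r f) = Matrix.det ((Polynomial.X : Polynomial Lambda) •
      (Matrix.of fun i j : Fin r => hInt ((f i : ℤ) - 1 - (i : ℤ) + (j : ℤ))).map (Polynomial.C : Lambda →+* Polynomial Lambda) +
      (Matrix.of fun i j : Fin r => hInt ((f i : ℤ) - (i : ℤ) + (j : ℤ))).map
        (Polynomial.C : Lambda →+* Polynomial Lambda)) := by
  rw [jacobiTrudi, AlgHom.map_det]
  congr 1
  ext i j : 2
  simp only [AlgHom.mapMatrix_apply, Matrix.map_apply, Matrix.of_apply, Matrix.add_apply,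
    Matrix.smul_apply, smul_eq_mul]
  rw [oddShift_hInt, add_comm]
  congr 4
  ring_nf

theorem coeff_oddShift_jacobiTrudi_eq_zero {r c : ℕ} (f : ℕ → ℕ) (hc : r < c) :
    (oddShift (jacobiTrudi r f)).coeff c = 0 := by
  apply Polynomial.coeff_eq_zero_of_natDegree_lt
  rw [oddShift_jacobiTrudi]
  refine (Polynomial.natDegree_det_X_add_C_le _ _).trans_lt ?_
  simpa using hc

theorem coeff_oddShift_jacobiTrudi_top {r : ℕ} {f : ℕ → ℕ} (hf : ∀ i < r, 0 < f i) :
    (oddShift (jacobiTrudi r f)).coeff r = jacobiTrudi r (fun i => f i - 1) := by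
  have := Polynomial.coeff_det_X_add_C_card
    (Matrix.of fun i j : Fin r => hInt ((f i : ℤ) - 1 - (i : ℤ) + (j : ℤ)))
    (Matrix.of fun i j : Fin r => hInt ((f i : ℤ) - (i : ℤ) + (j : ℤ)))
  rw [Fintype.card_fin] at this
  rw [oddShift_jacobiTrudi, this, jacobiTrudi]
  congr 1
  ext i j : 2
  have := hf i i.2
  simp only [Matrix.of_apply]
  congr 1
  push_cast [Nat.cast_sub (show 1 ≤ f i from this)]
  ring

/-- The matrix is bordered by the row $(1,-t,t^2,\dots)$. Adding $t$ times the preceding column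
reduces that row to $(1,0,\dots,0)$ and leaves the shifted determinant; expanding along the border
instead exhibits the minors as coefficients. -/
theorem coeff_oddShift_jacobiTrudi (r : ℕ) (f : ℕ → ℕ) (l : Fin (r + 1)) :
    (oddShift (jacobiTrudi r (fun i => f (i + 1)))).coeff l =
      Matrix.det (Matrix.of fun i j : Fin r =>
        hInt ((f (i + 1) : ℤ) - ((i : ℕ) + 1 : ℤ) + (l.succAbove j : ℤ))) := by
  let A : Matrix (Fin (r + 1)) (Fin (r + 1)) (Polynomial Lambda) := Matrix.of fun i j =>
    Fin.cases ((-Polynomial.X) ^ (j : ℕ))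
      (fun i : Fin r => Polynomial.C (hInt ((f (i + 1) : ℤ) - ((i : ℕ) + 1 : ℤ) + (j : ℤ)))) i
  let B : Matrix (Fin (r + 1)) (Fin (r + 1)) (Polynomial Lambda) := Matrix.of fun i j =>
    Fin.cases (if j = 0 then 1 else 0)
      (fun i : Fin r => Fin.cases
        (Polynomial.C (hInt ((f (i + 1) : ℤ) - ((i : ℕ) + 1 : ℤ))))
        (fun j : Fin r => oddShift (hInt ((f (i + 1) : ℤ) - (i : ℤ) + (j : ℤ)))) j) i
  have hAB : A.det = B.det := by
    apply Matrix.det_eq_of_forall_col_eq_smul_add_pred (fun _ => -Polynomial.X)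
    · intro i
      cases i using Fin.cases with
      | zero => simp [A, B]
      | succ i => simp [A, B]
    · intro i j
      cases i using Fin.cases with
      | zero =>
        simp only [A, B, Matrix.of_apply, Fin.cases_zero, Fin.succ_ne_zero, if_false, zero_add,
          Fin.val_succ, Fin.val_castSucc, pow_succ']
      | succ i =>
        simp only [A, B, Matrix.of_apply, Fin.cases_succ]
        rw [oddShift_hInt]
        have h1 : (f (i + 1) : ℤ) - ((i : ℕ) + 1 : ℤ) + (j.succ : ℤ) =
          (f (i + 1) : ℤ) - (i : ℤ) + (j : ℤ) := by simp only [Fin.val_succ]; push_cast; ring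
        have h2 : (f (i + 1) : ℤ) - ((i : ℕ) + 1 : ℤ) + (j.castSucc : ℤ) =
          (f (i + 1) : ℤ) - (i : ℤ) + (j : ℤ) - 1 := by simp only [Fin.val_castSucc]; ring
        rw [h1, h2]
        ring
  have hB : B.det = oddShift (jacobiTrudi r (fun i => f (i + 1))) := by
    rw [Matrix.det_succ_row_zero, Finset.sum_eq_single 0, jacobiTrudi, AlgHom.map_det]
    · have : B 0 0 = 1 := by simp [B]
      rw [this]
      simp only [Fin.val_zero, pow_zero, one_mul]
      congr 1
    · intro j _ hj
      have : B 0 j = 0 := by simp [B, hj]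
      rw [this]
      simp
    · simp
  have hA : A.det = ∑ j : Fin (r + 1), Polynomial.X ^ (j : ℕ) *
      Polynomial.C (Matrix.det (Matrix.of fun i k : Fin r =>
        hInt ((f (i + 1) : ℤ) - ((i : ℕ) + 1 : ℤ) + (j.succAbove k : ℤ)))) := by
    rw [Matrix.det_succ_row_zero]
    refine Finset.sum_congr rfl fun j _ => ?_
    have h0 : A 0 j = (-Polynomial.X) ^ (j : ℕ) := by simp [A]
    rw [h0, ← mul_pow, RingHom.map_det]
    congr 2
    ring_nf
  rw [← hB, ← hAB, hA, Polynomial.finsetSum_coeff, Finset.sum_eq_single l]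
  · rw [Polynomial.coeff_mul_C, Polynomial.coeff_X_pow_self, one_mul]
  · intro j _ hj
    rw [Polynomial.coeff_mul_C, Polynomial.coeff_X_pow, if_neg (fun h => hj (Fin.ext h.symm)),
      zero_mul]
  · simp

/-- Expansion of a Jacobi–Trudi determinant along its first row. -/
theorem jacobiTrudi_succ (r : ℕ) (f : ℕ → ℕ) :
    jacobiTrudi (r + 1) f = ∑ l ∈ Finset.range (r + 1), (-1) ^ l *
      h (f 0 + l) * (oddShift (jacobiTrudi r (fun i => f (i + 1)))).coeff l := by
  rw [Finset.sum_range, jacobiTrudi, Matrix.det_succ_row_zero]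
  refine Finset.sum_congr rfl fun l _ => ?_
  rw [coeff_oddShift_jacobiTrudi, ← hInt_natCast]
  have : ((f (0 : Fin (r + 1)) : ℤ) - ((0 : Fin (r + 1)) : ℤ) + (l : ℤ)) = ((f 0 + l : ℕ) : ℤ) := by
    simp
  simp only [Matrix.of_apply]
  rw [this]
  congr 2

/-! ### Orthonormality -/

theorem coeff_zero_oddShift (g : Lambda) : (oddShift g).coeff 0 = g := by
  apply eq_of_hall_eq
  intro v
  rw [hall_coeff_oddShift, e, h_zero, map_one, one_mul]

/-- Bernstein's formula for adding a row, with each $h_{f_0+l}$ moved across the pairing. -/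
theorem hall_jacobiTrudi_succ (r : ℕ) (f : ℕ → ℕ) (g : Lambda) :
    hall (jacobiTrudi (r + 1) f) g = ∑ l ∈ Finset.range (r + 1), (-1) ^ l *
      hall ((oddShift (jacobiTrudi r (fun i => f (i + 1)))).coeff l)
        ((evenShift g).coeff (f 0 + l)) := by
  rw [jacobiTrudi_succ, hall_sum_left]
  refine Finset.sum_congr rfl fun l _ => ?_
  rw [hall_comm _ ((evenShift g).coeff _), hall_coeff_evenShift, hall_comm g, ← hall_smul_left,
    mul_assoc]
  congr 1
  rw [MvPolynomial.smul_eq_C_mul]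
  simp

theorem hall_jacobiTrudi_of_lt {r s : ℕ} {f g : ℕ → ℕ} (hg : Antitone g) (hfg : g 0 < f 0) :
    hall (jacobiTrudi (r + 1) f) (jacobiTrudi s g) = 0 := by
  rw [hall_jacobiTrudi_succ]
  refine Finset.sum_eq_zero fun l _ => ?_
  rw [coeff_evenShift_jacobiTrudi_eq_zero hg (by omega), hall_zero_right, mul_zero]

theorem hall_jacobiTrudi_of_eq {r : ℕ} {f g : ℕ → ℕ} (hg : Antitone g) (hfg : f 0 = g 0) :
    hall (jacobiTrudi (r + 1) f) (jacobiTrudi (r + 1) g) =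
      hall (jacobiTrudi r fun i => f (i + 1)) (jacobiTrudi r fun i => g (i + 1)) := by
  rw [hall_jacobiTrudi_succ, Finset.sum_eq_single 0]
  · rw [add_zero, hfg, coeff_evenShift_jacobiTrudi_top hg, coeff_zero_oddShift]
    simp
  · intro l _ hl
    rw [coeff_evenShift_jacobiTrudi_eq_zero hg (by omega), hall_zero_right, mul_zero]
  · simp

/-- Induction on the number of rows. If the first rows differ, the larger one annihilates the other
determinant; if they agree, both are deleted. -/
theorem hall_jacobiTrudi {r : ℕ} {f g : ℕ → ℕ} (hf : Antitone f) (hg : Antitone g) :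
    hall (jacobiTrudi r f) (jacobiTrudi r g) = if ∀ i < r, f i = g i then 1 else 0 := by
  induction r generalizing f g with
  | zero =>
    rw [jacobiTrudi_zero, jacobiTrudi_zero, if_pos (by simp), ← h_zero, hall_comm]
    rw [h_zero, ← C_1, C_apply, hall_monomial_left, zed_zero]
    simp
  | succ r ih =>
    have key : (∀ i < r + 1, f i = g i) ↔ f 0 = g 0 ∧ ∀ i < r, f (i + 1) = g (i + 1) := by
      constructor
      · intro H
        exact ⟨H 0 (by omega), fun i hi => H (i + 1) (by omega)⟩
      · rintro ⟨h0, H⟩ i hi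
        cases i with
        | zero => exact h0
        | succ i => exact H i (by omega)
    rcases lt_trichotomy (f 0) (g 0) with h0 | h0 | h0
    · rw [hall_comm, hall_jacobiTrudi_of_lt hf h0, if_neg]
      rw [key]
      omega
    · rw [hall_jacobiTrudi_of_eq hg h0, ih (fun a b hab => hf (by omega))
        (fun a b hab => hg (by omega))]
      simp only [key, h0, true_and]
    · rw [hall_jacobiTrudi_of_lt hg h0, if_neg]
      rw [key]
      omega

/-! ### Conjugation and `ω` -/

/-- The first row of `f'` and the first column of `f` are removed together. Reducing to exactly `f'
0` rows makes $e_{f'_0}^\perp$ strip the column, while $e_{f'_0+l}^\perp$ vanishes for $l>0$. -/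
theorem hall_omega_jacobiTrudi {r s : ℕ} {f f' : ℕ → ℕ} (hconj : ∀ i j, j < f i ↔ i < f' j)
    (hr : f 0 ≤ r) (hs : f' 0 ≤ s) :
    hall (omega (jacobiTrudi r f')) (jacobiTrudi s f) = 1 := by
  induction r generalizing s f f' with
  | zero =>
    have hf0 : ∀ i, f i = 0 := by
      intro i
      by_contra hi
      have h1 := (hconj i 0).1 (by omega)
      have h2 := (hconj 0 0).2 (by omega)
      omega
    rw [jacobiTrudi_eq_of_le (Nat.zero_le s) (fun i _ => hf0 i), jacobiTrudi_zero,
      jacobiTrudi_zero, map_one]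
    have := hall_jacobiTrudi (r := 0) (f := fun _ => 0) (g := fun _ => 0) antitone_const
      antitone_const
    simpa [jacobiTrudi_zero] using this
  | succ r ih =>
    have hz : ∀ i, f' 0 ≤ i → f i = 0 := by
      intro i hi
      by_contra h
      have := (hconj i 0).1 (by omega)
      omega
    have hp : ∀ i < f' 0, 0 < f i := fun i hi => (hconj i 0).2 hi
    rw [jacobiTrudi_eq_of_le hs hz, hall_omega_left, hall_jacobiTrudi_succ,
      Finset.sum_eq_single 0]
    · rw [evenShift_omega, Polynomial.coeff_map, coeff_zero_oddShift, add_zero,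
        coeff_oddShift_jacobiTrudi_top hp]
      change (-1) ^ 0 * hall _ (omega _) = 1
      rw [← hall_omega_left, pow_zero, one_mul]
      apply ih
      · intro i j
        rw [← hconj]
        omega
      · omega
      · by_contra! hlt
        have h1 := (hconj (f' 0) 1).2 hlt
        have h2 := hz (f' 0) le_rfl
        omega
    · intro l _ hl
      rw [evenShift_omega, Polynomial.coeff_map, coeff_oddShift_jacobiTrudi_eq_zero (c := f' 0 + l) _ (by omega),
        map_zero, hall_zero_right, mul_zero]
    · simp

theorem antitone_of_conj {f f' : ℕ → ℕ} (hconj : ∀ i j, j < f i ↔ i < f' j) : Antitone f := by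
  intro a b hab
  by_contra! hlt
  have h1 := (hconj b (f a)).1 hlt
  have h2 := (hconj a (f a)).2 (by omega)
  omega

/-- Both sides are unit vectors with inner product 1, so their difference has norm $1-1-1+1=0$. -/
theorem omega_jacobiTrudi {r s : ℕ} {f f' : ℕ → ℕ} (hconj : ∀ i j, j < f i ↔ i < f' j)
    (hr : f 0 ≤ r) (hs : f' 0 ≤ s) : omega (jacobiTrudi r f') = jacobiTrudi s f := by
  rw [← sub_eq_zero]
  apply hall_self_eq_zero
  have hf : Antitone f := antitone_of_conj hconj
  have hf' : Antitone f' := antitone_of_conj fun i j => (hconj j i).symm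
  rw [hall_sub_left, hall_sub_right, hall_sub_right, hall_omega_omega,
    hall_comm (jacobiTrudi s f) (omega _), hall_omega_jacobiTrudi hconj hr hs,
    hall_jacobiTrudi hf hf, hall_jacobiTrudi hf' hf']
  simp

/-- Adding a first column of length `f' 0` to a Schur function, by the dual Bernstein operator. -/
theorem hall_jacobiTrudi_column {s r : ℕ} {f f' : ℕ → ℕ} (hconj : ∀ i j, j < f i ↔ i < f' j)
    (hr : f 0 ≤ r + 1) (hs : f' 0 ≤ s) (g : Lambda) :
    hall g (jacobiTrudi s f) = ∑ l ∈ Finset.range (r + 1), (-1) ^ l *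
      hall (h l * (oddShift g).coeff (f' 0 + l)) (jacobiTrudi s fun i => f i - 1) := by
  have hcol : omega (jacobiTrudi r fun i => f' (i + 1)) = jacobiTrudi s fun i => f i - 1 := by
    apply omega_jacobiTrudi
    · intro i j
      rw [← hconj]
      omega
    · omega
    · exact (antitone_of_conj (fun i j => (hconj j i).symm) (by omega)).trans hs
  -- The first column of `f` is the first row of `f'`, so the row formula is applied on the other
  -- side of $\omega$.
  rw [← omega_jacobiTrudi hconj hr hs, ← hall_omega_left, hall_comm, hall_jacobiTrudi_succ]
  refine Finset.sum_congr rfl fun l _ => ?_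
  rw [evenShift_omega, Polynomial.coeff_map, hall_coeff_oddShift, ← hcol,
    hall_comm _ (omega (jacobiTrudi r _)), hall_omega_left, map_mul]
  rfl

end SymFun

namespace Nat.Partition

/-! ### Rows of partitions -/

theorem lt_card_filter_iff_of_pairwise (L : List ℕ) (hL : L.Pairwise (· ≥ ·)) (i j : ℕ) :
    i < (L.filter (j < ·)).length ↔ j < L.getD i 0 := by
  induction L generalizing i with
  | nil => simp
  | cons a L ih =>
    rw [List.pairwise_cons] at hL
    by_cases ha : j < a
    · rw [List.filter_cons_of_pos (by simpa using ha), List.length_cons]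
      cases i with
      | zero => simpa using ha
      | succ i => simpa using ih hL.2 i
    · have : L.filter (j < ·) = [] := by
        rw [List.filter_eq_nil_iff]
        intro b hb
        have := hL.1 b hb
        simp only [decide_eq_true_eq]
        omega
      rw [List.filter_cons_of_neg (by simpa using ha), this]
      cases i with
      | zero => simpa using ha
      | succ i =>
        have := ih hL.2 i
        simp_all

/-- This removes the sorting from `row`; conjugation and column removal are then handled by counting
parts. -/
theorem lt_row_iff {n : ℕ} (lam : n.Partition) (i j : ℕ) :
    j < lam.row i ↔ i < Multiset.card (lam.parts.filter (j < ·)) := by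
  rw [row, ← lt_card_filter_iff_of_pairwise _ (Multiset.pairwise_sort _ _)]
  conv_rhs => rw [← Multiset.sort_eq lam.parts (· ≥ ·)]
  rw [Multiset.filter_coe, Multiset.coe_card]

theorem antitone_row {n : ℕ} (lam : n.Partition) : Antitone lam.row := by
  intro a b hab
  by_contra! h
  rw [lt_row_iff] at h
  have := (lam.lt_row_iff a (lam.row a)).2 (by omega)
  omega

theorem row_pos_iff {n : ℕ} (lam : n.Partition) (i : ℕ) : 0 < lam.row i ↔ i < lam.length := by
  rw [lt_row_iff, length, Multiset.filter_eq_self.2 fun a ha => lam.parts_pos ha]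

theorem row_eq_zero {n : ℕ} (lam : n.Partition) {i : ℕ} (hi : lam.length ≤ i) : lam.row i = 0 := by
  have := lam.row_pos_iff i
  omega

theorem row_le {n : ℕ} (lam : n.Partition) (i : ℕ) : lam.row i ≤ n := by
  by_contra! h
  rw [lt_row_iff, Multiset.filter_eq_nil.2] at h
  · simp at h
  · intro a ha
    have := lam.le_of_mem ha
    omega

theorem length_le {n : ℕ} (lam : n.Partition) : lam.length ≤ n := by
  conv_rhs => rw [← lam.parts_sum]
  have := Multiset.card_nsmul_le_sum (s := lam.parts) (a := 1) fun a ha => lam.parts_pos ha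
  simpa [length] using this

theorem eq_of_row_eq {n : ℕ} {lam μ : n.Partition} (H : ∀ i, lam.row i = μ.row i) : lam = μ := by
  have hc : ∀ j, Multiset.card (lam.parts.filter (j < ·)) =
      Multiset.card (μ.parts.filter (j < ·)) := by
    intro j
    by_contra hne
    rcases Nat.lt_or_gt_of_ne hne with h | h
    · have := (μ.lt_row_iff _ j).2 h
      rw [← H, lt_row_iff] at this
      omega
    · have := (lam.lt_row_iff _ j).2 h
      rw [H, lt_row_iff] at this
      omega
  have hcount : ∀ (s : Multiset ℕ) (a : ℕ), s.count (a + 1) +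
      Multiset.card (s.filter (a + 1 < ·)) = Multiset.card (s.filter (a < ·)) := by
    intro s a
    induction s using Multiset.induction_on with
    | empty => simp
    | cons b s ih =>
      rw [Multiset.count_cons, Multiset.filter_cons, Multiset.filter_cons, Multiset.card_add,
        Multiset.card_add, ← ih]
      rcases lt_trichotomy b (a + 1) with h | h | h
      · rw [if_neg (by omega), if_neg (by omega), if_neg (by omega)]; simp
      · rw [if_pos (by omega), if_neg (by omega), if_pos (by omega)]; simp; omega
      · rw [if_neg (by omega), if_pos (by omega), if_pos (by omega)]; simp; omega
  apply Nat.Partition.ext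
  ext a
  cases a with
  | zero =>
    rw [Multiset.count_eq_zero_of_notMem fun h => (lam.parts_pos h).ne rfl,
      Multiset.count_eq_zero_of_notMem fun h => (μ.parts_pos h).ne rfl]
  | succ a =>
    have h1 := hcount lam.parts a
    have h2 := hcount μ.parts a
    rw [hc, hc] at h1
    omega

theorem lt_row_ofSums_iff (n : ℕ) (s : Multiset ℕ) (hs : s.sum = n) (i j : ℕ) :
    j < (ofSums n s hs).row i ↔ i < Multiset.card (s.filter (j < ·)) := by
  rw [lt_row_iff, ofSums, Multiset.filter_filter]
  have : s.filter (fun a => j < a ∧ a ≠ 0) = s.filter (j < ·) :=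
    Multiset.filter_congr fun a _ => by omega
  rw [this]

theorem lt_row_conjugate_iff {n : ℕ} (lam : n.Partition) (i j : ℕ) :
    i < lam.conjugate.row j ↔ j < lam.row i := by
  rw [conjugate, lt_row_ofSums_iff, Multiset.filter_map, Multiset.card_map]
  have : (Multiset.range n).filter ((i < ·) ∘ fun j =>
      Multiset.card (lam.parts.filter (j < ·))) = Multiset.range (lam.row i) := by
    have h1 : (Multiset.range n).filter ((i < ·) ∘ fun j =>
      Multiset.card (lam.parts.filter (j < ·))) = (Multiset.range n).filter (· < lam.row i) :=
      Multiset.filter_congr fun a _ => (lam.lt_row_iff i a).symm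
    rw [h1]
    apply (Multiset.Nodup.ext (Multiset.nodup_range n |>.filter _) (Multiset.nodup_range _)).2
    intro a
    have := lam.row_le i
    simp only [Multiset.mem_filter, Multiset.mem_range]
    omega
  rw [this, Multiset.card_range]

theorem row_removeColumn {n : ℕ} (μ : n.Partition) (i : ℕ) :
    μ.removeColumn.row i = μ.row i - 1 := by
  have key : ∀ j, j < μ.removeColumn.row i ↔ j < μ.row i - 1 := by
    intro j
    rw [removeColumn, lt_row_ofSums_iff, Multiset.filter_map, Multiset.card_map,
      Nat.lt_sub_iff_add_lt, lt_row_iff]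
    have : μ.parts.filter ((j < ·) ∘ fun a => a - 1) = μ.parts.filter (j + 1 < ·) :=
      Multiset.filter_congr fun a _ => by simp only [Function.comp]; omega
    rw [this]
  have h1 := key (μ.row i - 1)
  have h2 := key (μ.removeColumn.row i)
  omega

theorem row_conjugate_zero {n : ℕ} (lam : n.Partition) : lam.conjugate.row 0 = lam.length := by
  have key : ∀ j, j < lam.conjugate.row 0 ↔ j < lam.length := fun j => by
    rw [lt_row_conjugate_iff, row_pos_iff]
  have h1 := key (lam.conjugate.row 0)
  have h2 := key lam.length
  omega

end Nat.Partition

namespace SymFun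

open MvPolynomial

/-! ### Schur functions: orthonormality, conjugation and one-row shapes -/

theorem schur_eq_jacobiTrudi {n r : ℕ} (lam : n.Partition) (hr : lam.length ≤ r) :
    schur lam = jacobiTrudi r lam.row :=
  (jacobiTrudi_eq_of_le hr fun _ hi => lam.row_eq_zero hi).symm

theorem hall_schur {n : ℕ} (lam μ : n.Partition) :
    hall (schur lam) (schur μ) = if lam = μ then 1 else 0 := by
  rw [schur_eq_jacobiTrudi lam lam.length_le, schur_eq_jacobiTrudi μ μ.length_le,
    hall_jacobiTrudi lam.antitone_row μ.antitone_row]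
  have : (∀ i < n, lam.row i = μ.row i) ↔ lam = μ := by
    constructor
    · intro H
      apply Nat.Partition.eq_of_row_eq
      intro i
      by_cases hi : i < n
      · exact H i hi
      · rw [lam.row_eq_zero (lam.length_le.trans (not_lt.1 hi)),
          μ.row_eq_zero (μ.length_le.trans (not_lt.1 hi))]
    · rintro rfl i _
      rfl
  simp only [this]

theorem omega_schur_conjugate {n : ℕ} (lam : n.Partition) :
    omega (schur lam.conjugate) = schur lam := by
  rw [schur_eq_jacobiTrudi lam lam.length_le,
    schur_eq_jacobiTrudi lam.conjugate lam.conjugate.length_le]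
  exact omega_jacobiTrudi (fun i j => (lam.lt_row_conjugate_iff i j).symm) (lam.row_le 0)
    (lam.conjugate.row_le 0)

theorem schur_oneRow (r : ℕ) : schur (oneRow r) = h r := by
  have hrow : ∀ i j, j < (oneRow r).row i ↔ i = 0 ∧ j < r := by
    intro i j
    refine (Nat.Partition.lt_row_ofSums_iff r {r} (Multiset.sum_singleton r) i j).trans ?_
    rw [Multiset.filter_singleton]
    split_ifs with hj
    · simp [hj]
    · simp [hj]
  have h0 : (oneRow r).row 0 = r := by
    have h1 := hrow 0 r
    have h2 := hrow 0 ((oneRow r).row 0)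
    omega
  have hlen : (oneRow r).length ≤ 1 := by
    by_contra! hl
    have := (hrow 1 0).1 (((oneRow r).row_pos_iff 1).2 hl)
    omega
  rw [schur_eq_jacobiTrudi _ hlen, jacobiTrudi, Matrix.det_fin_one]
  simp [h0, hInt_natCast]

/-! ### Homogeneity -/

/-- Homogeneity of a symmetric function, where `p_k` has degree `k`. -/
abbrev IsHomog (f : Lambda) (n : ℕ) : Prop :=
  IsWeightedHomogeneous (fun k : ℕ+ => (k : ℕ)) f n

theorem isHomog_h (n : ℕ) : IsHomog (h n) n := by
  intro d hd
  by_contra hw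
  exact hd (by rw [coeff_h, if_neg hw])

/-- In each term of the determinant the row and column shifts cancel. Individual indices may be
negative, so the grading is taken in `ℤ` and converted back at the end. -/
theorem isHomog_jacobiTrudi (r : ℕ) (f : ℕ → ℕ) :
    IsHomog (jacobiTrudi r f) (∑ i ∈ Finset.range r, f i) := by
  have hw : ∀ d : ℕ+ →₀ ℕ, Finsupp.weight (fun k : ℕ+ => ((k : ℕ) : ℤ)) d = (wt d : ℤ) := by
    intro d
    rw [Finsupp.weight_apply, wt, Finsupp.weight_apply, Finsupp.sum, Finsupp.sum]
    push_cast
    simp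
  have hInt_homog : ∀ a : ℤ,
      IsWeightedHomogeneous (fun k : ℕ+ => ((k : ℕ) : ℤ)) (hInt a) a := by
    intro a
    by_cases ha : 0 ≤ a
    · intro d hd
      rw [hInt, if_pos ha] at hd
      rw [hw]
      have := isHomog_h _ hd
      rw [this]
      omega
    · rw [hInt_of_neg (by omega)]
      exact isWeightedHomogeneous_zero _ _ _
  have key : IsWeightedHomogeneous (fun k : ℕ+ => ((k : ℕ) : ℤ)) (jacobiTrudi r f)
      (∑ i : Fin r, (f i : ℤ)) := by
    rw [jacobiTrudi, Matrix.det_apply]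
    apply IsWeightedHomogeneous.sum
    intro σ _
    have h1 : IsWeightedHomogeneous (fun k : ℕ+ => ((k : ℕ) : ℤ))
        (∏ i : Fin r, hInt ((f (σ i) : ℤ) - ((σ i : ℕ) : ℤ) + ((i : ℕ) : ℤ)))
        (∑ i : Fin r, ((f (σ i) : ℤ) - ((σ i : ℕ) : ℤ) + ((i : ℕ) : ℤ))) :=
      IsWeightedHomogeneous.prod _ _ _ fun i _ => hInt_homog _
    have h2 : (∑ i : Fin r, ((f (σ i) : ℤ) - ((σ i : ℕ) : ℤ) + ((i : ℕ) : ℤ))) =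
        ∑ i : Fin r, (f i : ℤ) := by
      rw [Finset.sum_add_distrib, Finset.sum_sub_distrib,
        Equiv.sum_comp σ fun i : Fin r => (f i : ℤ), Equiv.sum_comp σ fun i : Fin r => ((i : ℕ) : ℤ)]
      ring
    rw [h2] at h1
    rcases Int.units_eq_one_or (Equiv.Perm.sign σ) with hs | hs
    · rw [hs, one_smul]
      exact h1
    · rw [hs, Units.neg_smul, one_smul]
      intro d hd
      apply h1
      simpa using hd
  intro d hd
  have := key hd
  rw [hw] at this
  rw [Finset.sum_range]
  exact_mod_cast this

theorem isHomog_schur {n : ℕ} (lam : n.Partition) : IsHomog (schur lam) n := by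
  have h1 := isHomog_jacobiTrudi lam.length lam.row
  have h2 : ∑ i ∈ Finset.range lam.length, lam.row i = n := by
    conv_rhs => rw [← lam.parts_sum, ← Multiset.sort_eq lam.parts (· ≥ ·), Multiset.sum_coe]
    have hlen : lam.length = (lam.parts.sort (· ≥ ·)).length := (Multiset.length_sort _).symm
    rw [hlen, Finset.sum_range]
    simp only [Nat.Partition.row]
    rw [← Fin.sum_univ_getElem]
    exact Finset.sum_congr rfl fun i _ => List.getD_eq_getElem _ _ i.2
  rw [h2] at h1
  exact h1

theorem IsHomog.rename {g : Lambda} {b : ℕ} (hg : IsHomog g b) (k : ℕ+) :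
    IsHomog (MvPolynomial.rename (fun j : ℕ+ => k * j) g) (k * b) := by
  intro d hd
  obtain ⟨u, rfl, hu⟩ := coeff_rename_ne_zero _ _ _ hd
  have := hg hu
  rw [← this, Finsupp.weight_apply, Finsupp.weight_apply, Finsupp.sum_mapDomain_index]
  · simp only [Finsupp.sum, Finset.mul_sum, smul_eq_mul, PNat.mul_coe]
    exact Finset.sum_congr rfl fun _ _ => by ring
  · simp
  · intros; simp [add_mul]

theorem IsHomog.plethysm {f g : Lambda} {a b : ℕ} (hf : IsHomog f a) (hg : IsHomog g b) :
    IsHomog (plethysm f g) (a * b) := by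
  rw [SymFun.plethysm, f.as_sum, map_sum]
  apply IsWeightedHomogeneous.sum
  intro d hd
  have hw := hf (MvPolynomial.mem_support_iff.1 hd)
  rw [aeval_monomial, Finsupp.prod, algebraMap_eq]
  have h1 : IsHomog (∏ k ∈ d.support, (MvPolynomial.rename (fun j : ℕ+ => k * j) g) ^ d k)
      (∑ k ∈ d.support, d k • ((k : ℕ) * b)) :=
    IsWeightedHomogeneous.prod _ _ _ fun k _ => (hg.rename k).pow _
  have h2 : ∑ k ∈ d.support, d k • ((k : ℕ) * b) = a * b := by
    rw [← hw, Finsupp.weight_apply, Finsupp.sum, Finset.sum_mul]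
    exact Finset.sum_congr rfl fun _ _ => by simp [mul_assoc]
  rw [h2] at h1
  have := (isWeightedHomogeneous_C (fun k : ℕ+ => (k : ℕ)) (f.coeff d)).mul h1
  rwa [zero_add] at this

theorem IsHomog.omega {f : Lambda} {a : ℕ} (hf : IsHomog f a) : IsHomog (omega f) a := by
  intro d hd
  rw [coeff_omega] at hd
  exact hf (right_ne_zero_of_mul hd)

/-! ### Completeness of the Schur functions -/

theorem eq_of_coeff_mult {n : ℕ} {f g : Lambda} (hf : IsHomog f n) (hg : IsHomog g n)
    (H : ∀ ρ : n.Partition, f.coeff (mult ρ) = g.coeff (mult ρ)) : f = g := by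
  ext d
  by_cases hd : wt d = n
  · obtain ⟨ρ, rfl⟩ := exists_mult_eq hd
    exact H ρ
  · rw [hf.coeff_eq_zero d hd, hg.coeff_eq_zero d hd]

theorem hall_eq_sum_partition {n : ℕ} {f : Lambda} (hf : IsHomog f n) (g : Lambda) :
    hall f g = ∑ ρ : n.Partition, zed (mult ρ) * (f.coeff (mult ρ) * g.coeff (mult ρ)) := by
  classical
  rw [hall_eq_sum f g (Finset.univ.image (mult (n := n))),
    Finset.sum_image fun a _ b _ hab => mult_injective n hab]
  intro d hd
  obtain ⟨ρ, rfl⟩ := exists_mult_eq (hf (MvPolynomial.mem_support_iff.1 hd))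
  exact Finset.mem_image_of_mem _ (Finset.mem_univ ρ)

/-- Orthonormality says that $AB=1$ for square matrices indexed by partitions of $n$; hence $BA=1$,
which is completeness. -/
theorem sum_coeff_schur {n : ℕ} (ρ σ : n.Partition) :
    ∑ lam : n.Partition, zed (mult ρ) * (schur lam).coeff (mult ρ) * (schur lam).coeff (mult σ) =
      if ρ = σ then 1 else 0 := by
  let A : Matrix n.Partition n.Partition ℚ := Matrix.of fun lam ρ => (schur lam).coeff (mult ρ)
  let B : Matrix n.Partition n.Partition ℚ :=
    Matrix.of fun ρ lam => zed (mult ρ) * (schur lam).coeff (mult ρ)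
  have hAB : A * B = 1 := by
    ext lam μ
    rw [Matrix.mul_apply, Matrix.one_apply, ← hall_schur, hall_eq_sum_partition (isHomog_schur lam)]
    refine Finset.sum_congr rfl fun τ _ => ?_
    simp only [A, B, Matrix.of_apply]
    ring
  have hBA := congrFun (congrFun (mul_eq_one_comm.1 hAB : B * A = 1) ρ) σ
  rw [Matrix.mul_apply, Matrix.one_apply] at hBA
  exact hBA

theorem sum_hall_smul_schur {n : ℕ} {f : Lambda} (hf : IsHomog f n) :
    ∑ lam : n.Partition, hall f (schur lam) • schur lam = f := by
  apply eq_of_coeff_mult _ hf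
  · intro σ
    rw [coeff_sum]
    simp only [coeff_smul, hall_eq_sum_partition hf, smul_eq_mul, Finset.sum_mul]
    rw [Finset.sum_comm, Finset.sum_eq_single σ]
    · have := sum_coeff_schur σ σ
      rw [if_pos rfl] at this
      conv_rhs => rw [← mul_one (coeff (mult σ) f), ← this, Finset.mul_sum]
      exact Finset.sum_congr rfl fun _ _ => by ring
    · intro ρ _ hρ
      have := sum_coeff_schur ρ σ
      rw [if_neg hρ] at this
      rw [← mul_zero (coeff (mult ρ) f), ← this, Finset.mul_sum]
      exact Finset.sum_congr rfl fun _ _ => by ring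
    · simp
  · apply IsWeightedHomogeneous.sum
    intro lam _
    rw [smul_eq_C_mul]
    have := (isWeightedHomogeneous_C (fun k : ℕ+ => (k : ℕ)) (hall f (schur lam))).mul
      (isHomog_schur lam)
    rwa [zero_add] at this

theorem sum_hall_mul_hall {n : ℕ} {f : Lambda} (hf : IsHomog f n) (F : Lambda →ₗ[ℚ] ℚ) :
    ∑ lam : n.Partition, hall f (schur lam) * F (schur lam) = F f := by
  conv_rhs => rw [← sum_hall_smul_schur hf]
  simp

end SymFun

namespace SymFun

open MvPolynomial

/-! ### The coproduct -/

/-- The coproduct `p_k ↦ p_k ⊗ 1 + 1 ⊗ p_k`, with the second tensor factor written as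
polynomials over the first one. -/
def comult : Lambda →ₐ[ℚ] MvPolynomial ℕ+ Lambda := aeval fun k => C (X k) + X k

theorem comult_X (k : ℕ+) : comult (X k) = C (X k) + X k := aeval_X _ _

/-- Duality of coproduct and product. The induction is that of `hall_coeff_evenShift`, with the
Leibniz rule now applied to $u\,p_\sigma$. -/
theorem hall_coeff_comult (σ : ℕ+ →₀ ℕ) (g u : Lambda) :
    zed σ * hall ((comult g).coeff σ) u = hall g (u * monomial σ 1) := by
  classical
  induction g using MvPolynomial.induction_on generalizing σ u with
  | C a =>
    have h1 : comult (C a) = C (C a) := by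
      rw [← algebraMap_eq, AlgHom.commutes]
      rfl
    have h2 : ∀ w : Lambda, hall (C a) w = a * w.coeff 0 := fun w => by
      rw [C_apply, hall_monomial_left, zed_zero, one_mul]
    rw [h1, coeff_C, h2, coeff_mul_monomial']
    by_cases hσ : σ = 0
    · subst hσ
      rw [if_pos rfl, h2, zed_zero, if_pos le_rfl]
      simp
    · rw [if_neg (Ne.symm hσ), if_neg (fun h => hσ (nonpos_iff_eq_zero.1 h)), hall_zero_left]
      simp
  | add p q hp hq => rw [map_add, coeff_add, hall_add_left, mul_add, hp, hq, hall_add_left]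
  | mul_X p k ih =>
    have hd : ((k : ℕ) : ℚ) • pderiv k (u * monomial σ 1) =
        (((k : ℕ) : ℚ) • pderiv k u) * monomial σ 1 +
          u * (((k : ℕ) : ℚ) • pderiv k (monomial σ 1)) := by
      rw [Derivation.leibniz, smul_add, smul_eq_mul, smul_eq_mul, mul_smul_comm, add_comm,
        smul_mul_assoc, mul_comm (monomial σ 1)]
    rw [map_mul, comult_X, mul_add, coeff_add, mul_comm _ (C (X k)), coeff_C_mul, coeff_mul_X',
      hall_add_left, hall_X_mul, mul_add, ih, mul_comm p, hall_X_mul, hd, hall_add_right]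
    congr 1
    by_cases hk : k ∈ σ.support
    · obtain ⟨τ, rfl⟩ : ∃ τ, σ = τ + Finsupp.single k 1 :=
        ⟨σ - Finsupp.single k 1, (tsub_add_cancel_of_le (by
          rw [Finsupp.single_le_iff]
          exact Nat.one_le_iff_ne_zero.2 (Finsupp.mem_support_iff.1 hk))).symm⟩
      rw [if_pos hk, pderiv_monomial, add_tsub_cancel_right, zed_add_single]
      have hm : ((k : ℕ) : ℚ) • (monomial τ (1 * (((τ + Finsupp.single k 1 : ℕ+ →₀ ℕ) k : ℕ) : ℚ)) :
          Lambda) = (((k : ℕ) : ℚ) * (τ k + 1)) • monomial τ 1 := by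
        rw [smul_monomial, smul_monomial]
        congr 1
        simp
      rw [hm, mul_smul_comm, hall_smul_right, ← ih]
      ring
    · rw [if_neg hk, pderiv_monomial, Finsupp.notMem_support_iff.1 hk, hall_zero_left]
      simp [hall_zero_right]

theorem coeff_coeff_comult (g : Lambda) (ρ σ : ℕ+ →₀ ℕ) :
    zed σ * (zed ρ * ((comult g).coeff σ).coeff ρ) = zed (ρ + σ) * g.coeff (ρ + σ) := by
  have := hall_coeff_comult σ g (monomial ρ 1)
  rw [monomial_mul, one_mul, hall_monomial_right, hall_monomial_right] at this
  simpa using this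

theorem wt_add_eq_of_coeff_comult {g : Lambda} {n : ℕ} (hg : IsHomog g n) {ρ σ : ℕ+ →₀ ℕ}
    (H : ((comult g).coeff σ).coeff ρ ≠ 0) : wt ρ + wt σ = n := by
  rw [← map_add]
  apply hg
  intro h0
  have := coeff_coeff_comult g ρ σ
  rw [h0, mul_zero] at this
  have hz1 := zed_ne_zero σ
  have hz2 := zed_ne_zero ρ
  simp_all

theorem isHomog_coeff_comult {g : Lambda} {n i : ℕ} (hg : IsHomog g n) {σ : ℕ+ →₀ ℕ}
    (hσ : wt σ + i = n) : IsHomog ((comult g).coeff σ) i := by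
  intro ρ hρ
  have := wt_add_eq_of_coeff_comult hg hρ
  change wt ρ = i
  omega

theorem coeff_comult_eq_zero {g : Lambda} {n : ℕ} (hg : IsHomog g n) {σ : ℕ+ →₀ ℕ}
    (hσ : n < wt σ) : (comult g).coeff σ = 0 := by
  ext ρ
  by_contra hρ
  have := wt_add_eq_of_coeff_comult hg hρ
  omega

/-! ### Evaluation at a sum of an ordinary and an odd alphabet -/

/-- The homomorphism `p_k ↦ A(p_k) - (-t)^k B(p_k)`, a graded version of `A[X] + ε B[X]`. -/
def twistedSum (A B : Lambda →ₐ[ℚ] Lambda) : Lambda →ₐ[ℚ] Polynomial Lambda :=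
  aeval fun k => Polynomial.C (A (X k)) - (-Polynomial.X) ^ (k : ℕ) * Polynomial.C (B (X k))

theorem neg_neg_pow_mul_eq {R : Type*} [CommRing R] (φ : ℚ →+* R) (x y : R) (k : ℕ+) :
    -((-x) ^ (k : ℕ) * y) = φ (sgn k) * x ^ (k : ℕ) * y := by
  rw [neg_pow, sgn, map_pow, map_neg, map_one]
  ring

theorem neg_neg_X_pow_mul_C (k : ℕ+) (b : Lambda) :
    -((-Polynomial.X : Polynomial Lambda) ^ (k : ℕ) * Polynomial.C b) =
      Polynomial.C (C (sgn k)) * Polynomial.X ^ (k : ℕ) * Polynomial.C b :=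
  neg_neg_pow_mul_eq ((Polynomial.C : Lambda →+* Polynomial Lambda).comp C) Polynomial.X _ k

theorem twistedSum_eq (A B : Lambda →ₐ[ℚ] Lambda) (g : Lambda) :
    twistedSum A B g = ∑ σ ∈ (comult g).support,
      Polynomial.C (sgnMon σ • (A ((comult g).coeff σ) * B (monomial σ 1))) *
        Polynomial.X ^ wt σ := by
  let y : ℕ+ → Polynomial Lambda := fun k =>
    -((-Polynomial.X) ^ (k : ℕ) * Polynomial.C (B (X k)))
  -- The homomorphism factors through the coproduct: `A` acts on the first factor, and the signed,
  -- $t$-graded values of `B` replace the variables of the second.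
  have h1 : ((MvPolynomial.eval₂Hom ((Polynomial.C : Lambda →+* Polynomial Lambda).comp
      (A : Lambda →+* Lambda)) y).comp (comult : Lambda →+* MvPolynomial ℕ+ Lambda)) =
      (twistedSum A B : Lambda →+* Polynomial Lambda) := by
    apply MvPolynomial.ringHom_ext
    · intro r
      have e1 : comult (C r) = C (C r) := by
        rw [← algebraMap_eq, AlgHom.commutes]
        rfl
      have e2 : twistedSum A B (C r) = Polynomial.C (C r) := by
        rw [← algebraMap_eq, AlgHom.commutes]
        rfl
      have e3 : A (C r) = C r := by
        rw [← algebraMap_eq, AlgHom.commutes]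
      simp only [RingHom.comp_apply, RingHom.coe_coe, e1, e2, coe_eval₂Hom, eval₂_C, e3]
    · intro k
      have e2 : twistedSum A B (X k) = Polynomial.C (A (X k)) + y k := by
        rw [twistedSum, aeval_X, sub_eq_add_neg]
      simp only [RingHom.comp_apply, RingHom.coe_coe, comult_X, e2, coe_eval₂Hom, eval₂_add,
        eval₂_C, eval₂_X]
  have h2 := RingHom.congr_fun h1 g
  simp only [RingHom.comp_apply, RingHom.coe_coe, coe_eval₂Hom] at h2
  rw [← h2, eval₂_eq]
  refine Finset.sum_congr rfl fun σ _ => ?_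
  have h3 : ∏ k ∈ σ.support, y k ^ σ k =
      Polynomial.C (C (sgnMon σ) * B (monomial σ 1)) * Polynomial.X ^ wt σ := by
    simp only [y, neg_neg_X_pow_mul_C, mul_pow]
    rw [Finset.prod_mul_distrib, Finset.prod_mul_distrib, sgnMon, monomial_eq, wt,
      Finsupp.weight_apply, Finsupp.prod, Finsupp.prod, Finsupp.sum, ← Finset.prod_pow_eq_pow_sum]
    simp only [map_mul, map_prod, map_pow, map_one, one_mul, ← pow_mul, smul_eq_mul]
    rw [mul_right_comm]
    congr 1
    exact Finset.prod_congr rfl fun k _ => by rw [mul_comm]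
  rw [h3, smul_eq_C_mul]
  simp only [RingHom.comp_apply, RingHom.coe_coe, map_mul]
  ring

theorem coeff_twistedSum (A B : Lambda →ₐ[ℚ] Lambda) (g : Lambda) (j : ℕ) :
    (twistedSum A B g).coeff j = ∑ σ : j.Partition,
      sgnMon (mult σ) • (A ((comult g).coeff (mult σ)) * B (monomial (mult σ) 1)) := by
  classical
  rw [twistedSum_eq, Polynomial.finsetSum_coeff]
  simp only [Polynomial.coeff_C_mul, Polynomial.coeff_X_pow, mul_ite, mul_one, mul_zero]
  rw [← Finset.sum_filter]
  have h1 : ∑ σ : j.Partition,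
      sgnMon (mult σ) • (A ((comult g).coeff (mult σ)) * B (monomial (mult σ) 1)) =
      ∑ σ ∈ Finset.univ.image (mult (n := j)),
      sgnMon σ • (A ((comult g).coeff σ) * B (monomial σ 1)) :=
    (Finset.sum_image (f := fun σ => sgnMon σ • (A ((comult g).coeff σ) * B (monomial σ 1)))
      fun a _ b _ hab => mult_injective j hab).symm
  rw [h1]
  apply Finset.sum_subset
  · intro σ hσ
    obtain ⟨ρ, rfl⟩ := exists_mult_eq (Finset.mem_filter.1 hσ).2.symm
    exact Finset.mem_image_of_mem _ (Finset.mem_univ ρ)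
  · intro σ hσ hn
    obtain ⟨ρ, -, rfl⟩ := Finset.mem_image.1 hσ
    have : (comult g).coeff (mult ρ) = 0 := by
      by_contra hne
      exact hn (Finset.mem_filter.2 ⟨MvPolynomial.mem_support_iff.2 hne, (wt_mult ρ).symm⟩)
    rw [this]
    simp

theorem coeff_twistedSum_eq_zero (A B : Lambda →ₐ[ℚ] Lambda) {g : Lambda} {n j : ℕ}
    (hg : IsHomog g n) (hj : n < j) : (twistedSum A B g).coeff j = 0 := by
  rw [coeff_twistedSum]
  refine Finset.sum_eq_zero fun σ _ => ?_
  rw [coeff_comult_eq_zero hg (by rwa [wt_mult])]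
  simp

/-- Expansion of the canonical tensor of the Hall inner product in the two dual bases. -/
theorem sum_powerSum_eq_sum_schur (j : ℕ) (F : Lambda →ₗ[ℚ] ℚ) :
    ∑ σ : j.Partition, ((zed (mult σ))⁻¹ * F (monomial (mult σ) 1)) •
      (monomial (mult σ) 1 : Lambda) = ∑ η : j.Partition, F (schur η) • schur η := by
  have hmon : ∀ σ : j.Partition, IsHomog (monomial (mult σ) 1 : Lambda) j := fun σ =>
    isWeightedHomogeneous_monomial _ _ _ (wt_mult σ)
  have h1 : ∀ η : j.Partition, schur η =
      ∑ σ : j.Partition, (schur η).coeff (mult σ) • (monomial (mult σ) 1 : Lambda) := by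
    intro η
    apply eq_of_coeff_mult (isHomog_schur η)
    · apply IsWeightedHomogeneous.sum
      intro σ _
      rw [smul_eq_C_mul]
      exact (hmon σ).C_mul _
    · classical
      intro ρ
      rw [coeff_sum, Finset.sum_eq_single ρ]
      · simp
      · intro σ _ hσ
        rw [coeff_smul, coeff_monomial, if_neg fun H => hσ (mult_injective j H), smul_zero]
      · simp
  conv_rhs =>
    enter [2, η]
    rw [h1 η, Finset.smul_sum]
  rw [Finset.sum_comm]
  refine Finset.sum_congr rfl fun σ _ => ?_
  simp only [smul_smul]
  rw [← Finset.sum_smul]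
  congr 1
  rw [← sum_hall_mul_hall (hmon σ) F, Finset.mul_sum]
  refine Finset.sum_congr rfl fun η _ => ?_
  rw [hall_monomial_left, ← h1]
  have := zed_ne_zero (mult σ)
  field_simp

theorem omega_schur {n : ℕ} (lam : n.Partition) : omega (schur lam) = schur lam.conjugate := by
  rw [← omega_schur_conjugate, omega_omega]

/-- The coproduct of $s_{\lambda'}$ is a sum of $c^\lambda_{\eta,\beta}\,s_{\beta'}\otimes
s_{\eta'}$; the sign twist on the second factor is $\omega$, which turns $s_{\eta'}$ into $s_\eta$.
-/
theorem coeff_twistedSum_schur (A B : Lambda →ₐ[ℚ] Lambda) {n i : ℕ} (hi : i ≤ n)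
    (lam : n.Partition) :
    (twistedSum A B (schur lam.conjugate)).coeff (n - i) =
      ∑ β : i.Partition, ∑ η : (n - i).Partition,
        lrCoeff lam η β • (A (schur β.conjugate) * B (schur η)) := by
  rw [coeff_twistedSum]
  have h1 : ∀ σ : (n - i).Partition, A ((comult (schur lam.conjugate)).coeff (mult σ)) =
      ∑ β : i.Partition, ((zed (mult σ))⁻¹ * sgnMon (mult σ) *
        hall (schur lam) (schur β * monomial (mult σ) 1)) • A (schur β.conjugate) := by
    intro σ
    set x := (comult (schur lam.conjugate)).coeff (mult σ) with hx
    have hhom : IsHomog (omega x) i :=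
      (isHomog_coeff_comult (isHomog_schur lam.conjugate) (by rw [wt_mult]; omega)).omega
    have h2 := congrArg omega (sum_hall_smul_schur hhom)
    rw [omega_omega] at h2
    rw [← h2, map_sum, map_sum]
    refine Finset.sum_congr rfl fun β _ => ?_
    rw [map_smul, map_smul, omega_schur]
    congr 1
    have h3 := hall_coeff_comult (mult σ) (schur lam.conjugate) (schur β.conjugate)
    rw [← hx, ← omega_schur lam, hall_omega_left, map_mul, omega_schur_conjugate, omega_monomial,
      mul_one] at h3
    have h4 : (monomial (mult σ) (sgnMon (mult σ)) : Lambda) =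
        sgnMon (mult σ) • monomial (mult σ) 1 := by rw [smul_monomial]; simp
    rw [h4, mul_smul_comm, hall_smul_right] at h3
    rw [hall_omega_left, omega_schur, mul_assoc, ← h3]
    have := zed_ne_zero (mult σ)
    field_simp
  simp only [h1, Finset.sum_mul, Finset.smul_sum]
  rw [Finset.sum_comm]
  refine Finset.sum_congr rfl fun β _ => ?_
  let F : Lambda →ₗ[ℚ] ℚ := hallForm (schur lam) ∘ₗ LinearMap.mulLeft ℚ (schur β)
  have hF : ∀ x, F x = hall (schur lam) (schur β * x) := fun _ => rfl
  have h5 := congrArg (fun x => A (schur β.conjugate) * B x) (sum_powerSum_eq_sum_schur (n - i) F)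
  simp only [map_sum, map_smul, Finset.mul_sum, mul_smul_comm] at h5
  refine Eq.trans (Finset.sum_congr rfl fun σ _ => ?_) (h5.trans (Finset.sum_congr rfl fun η _ => ?_))
  · rw [smul_mul_assoc, smul_smul, hF]
    congr 1
    rw [mul_assoc, mul_left_comm, ← mul_assoc (sgnMon _) (sgnMon _), sgnMon_mul_self, one_mul]
  · rw [hF, lrCoeff, hall_comm, mul_comm (schur β)]

/-! ### Plethysm -/

/-- Plethysm `f ↦ f ∘ g` as an algebra homomorphism. -/
def plethysmHom (g : Lambda) : Lambda →ₐ[ℚ] Lambda :=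
  aeval fun k : ℕ+ => MvPolynomial.rename (fun j : ℕ+ => k * j) g

theorem plethysmHom_apply (f g : Lambda) : plethysmHom g f = plethysm f g := rfl

theorem oddShift_plethysm (f : Lambda) (m : ℕ) :
    oddShift (plethysm f (h (m + 1))) =
      twistedSum (plethysmHom (h (m + 1))) (plethysmHom (h m)) f := by
  have : oddShift.comp (plethysmHom (h (m + 1))) =
      twistedSum (plethysmHom (h (m + 1))) (plethysmHom (h m)) := by
    apply MvPolynomial.algHom_ext
    intro k
    -- After $p_j\mapsto p_{kj}$ the added term is $-(-t)^{kj}$, that of a single odd variable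
    -- $T=-(-t)^k$.
    have h1 := map_h_succ_of_add_odd (constHom.comp (MvPolynomial.rename fun j : ℕ+ => k * j))
      (oddShift.comp (MvPolynomial.rename fun j : ℕ+ => k * j)) (-(-Polynomial.X) ^ (k : ℕ))
      (fun j => by
        rw [AlgHom.comp_apply, AlgHom.comp_apply, rename_X, oddShift_X, neg_neg, ← pow_mul,
          PNat.mul_coe, constHom_apply]) m
    simp only [AlgHom.comp_apply, constHom_apply] at h1
    simp only [AlgHom.comp_apply, plethysmHom, twistedSum, aeval_X]
    rw [h1]
    ring
  exact AlgHom.congr_fun this f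

/-! ### Skew plethysm coefficients and the column expansion -/

/-- The sum over $\zeta$ is the Schur expansion of the plethysm; `hdeg` ensures that $\zeta$ runs
through the degree in which the plethysm lives. -/
theorem skewPlethysmCoeff_eq {a b c d e' : ℕ} (α : a.Partition) (β : b.Partition)
    (γ : c.Partition) (δ : d.Partition) (ν : e'.Partition) (hdeg : (c - d) * e' = a - b) :
    skewPlethysmCoeff α β γ δ ν = ∑ η : (c - d).Partition,
      lrCoeff γ η δ * hall (plethysm (schur η) (schur ν) * schur β) (schur α) := by
  refine Finset.sum_congr rfl fun η _ => ?_
  let F : Lambda →ₗ[ℚ] ℚ := hallForm (schur α) ∘ₗ LinearMap.mulLeft ℚ (schur β)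
  have hF : ∀ x, F x = hall (x * schur β) (schur α) := fun x => by
    rw [hall_comm, mul_comm]; rfl
  have hhom : IsHomog (plethysm (schur η) (schur ν)) (a - b) :=
    hdeg ▸ (isHomog_schur η).plethysm (isHomog_schur ν)
  rw [← hF, ← sum_hall_mul_hall hhom F, Finset.mul_sum]
  refine Finset.sum_congr rfl fun ζ _ => ?_
  rw [hF, lrCoeff, lrCoeff, plethysmCoeff]
  ring

theorem skewPlethysmCoeff_oneRow_zero {a i r m : ℕ} (α : a.Partition) (γ : i.Partition)
    (hdeg : i * m = a - r) :
    skewPlethysmCoeff α (oneRow r) γ (oneRow 0) (oneRow m) =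
      hall (plethysm (schur γ) (h m) * h r) (schur α) := by
  rw [skewPlethysmCoeff_eq _ _ _ _ _ hdeg]
  let F : Lambda →ₗ[ℚ] ℚ :=
    hallForm (schur α) ∘ₗ LinearMap.mulLeft ℚ (h r) ∘ₗ (plethysmHom (h m)).toLinearMap
  have hF : ∀ x, F x = hall (plethysm x (h m) * h r) (schur α) := fun x => by
    rw [hall_comm, mul_comm]; rfl
  rw [← hF, ← sum_hall_mul_hall (isHomog_schur γ) F]
  refine Finset.sum_congr rfl fun η _ => ?_
  rw [hF, lrCoeff, schur_oneRow, schur_oneRow, schur_oneRow, h_zero, mul_one, hall_comm]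

/-- The plethysm coefficients for `μ` of length `n - k`, in terms of the adjoints of multiplication
by elementary symmetric functions. -/
theorem plethysmCoeff_eq_sum_oddShift {n m k : ℕ} (hk : k ≤ n) (lam : n.Partition)
    (μ : Nat.Partition ((m + 1) * n)) (hμ : μ.length = n - k) :
    plethysmCoeff μ lam.conjugate (oneRow (m + 1)) = ∑ i ∈ Finset.range (k + 1),
      (-1) ^ (k + i) * hall (h (k - i) *
        (oddShift (plethysm (schur lam.conjugate) (h (m + 1)))).coeff (n - i))
          (schur μ.removeColumn) := by
  have hlen : μ.removeColumn.length ≤ (m + 1) * n := by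
    refine μ.removeColumn.length_le.trans ?_
    omega
  have hrow : (fun i => μ.row i - 1) = μ.removeColumn.row :=
    funext fun i => (μ.row_removeColumn i).symm
  -- Any `r` bounding the first row of `μ` would do for the expansion; the extra `k` guarantees that
  -- its range contains all $l\le k$.
  rw [plethysmCoeff, schur_oneRow, schur_eq_jacobiTrudi μ μ.length_le,
    hall_jacobiTrudi_column (r := (m + 1) * n + k)
      (fun i j => (μ.lt_row_conjugate_iff i j).symm) (by have := μ.row_le 0; omega)
      (μ.conjugate.row_le 0), hrow, ← schur_eq_jacobiTrudi _ hlen, μ.row_conjugate_zero.trans hμ]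
  have hsub : Finset.range (k + 1) ⊆ Finset.range ((m + 1) * n + k + 1) :=
    Finset.range_subset_range.2 (by omega)
  rw [← Finset.sum_subset hsub, ← Finset.sum_range_reflect]
  · refine Finset.sum_congr rfl fun i hi => ?_
    have hik : i ≤ k := Nat.lt_succ_iff.1 (Finset.mem_range.1 hi)
    have e1 : k + 1 - 1 - i = k - i := by omega
    have e2 : n - k + (k - i) = n - i := by omega
    have e3 : k + i = k - i + 2 * i := by omega
    rw [e1, e2, e3, pow_add, pow_mul]
    simp
  -- For $l>k$ the power $t^{n-k+l}$ exceeds the degree $n$ of $s_{\lambda'}$.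
  · intro l _ hl
    have : k < l := by simpa using hl
    rw [oddShift_plethysm, coeff_twistedSum_eq_zero _ _ (isHomog_schur _) (by omega), mul_zero,
      hall_zero_left, mul_zero]

/-- For each $\beta$ and $\eta$, the sum over $\alpha$ is the Schur expansion of
$h_{k-i}\,(s_{\beta'}\circ h_{m+1})$, inserted into the pairing of its product with $s_\eta\circ
h_m$ against $s_{\hat\mu}$. -/
theorem sum_skewPlethysmCoeff_mul {n m k i : ℕ} (hik : i ≤ k) (hk : k ≤ n) (lam : n.Partition)
    (μ : Nat.Partition ((m + 1) * n)) (hμ : μ.length = n - k) :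
    ∑ α : Nat.Partition (k + m * i), ∑ β : Nat.Partition i,
      skewPlethysmCoeff α (oneRow (k - i)) β.conjugate (oneRow 0) (oneRow (m + 1)) *
        skewPlethysmCoeff μ.removeColumn α lam β (oneRow m) =
      hall (h (k - i) * (oddShift (plethysm (schur lam.conjugate) (h (m + 1)))).coeff (n - i))
        (schur μ.removeColumn) := by
  have hdeg1 : i * (m + 1) = k + m * i - (k - i) := by
    have : i * (m + 1) = m * i + i := by ring
    omega
  have hdeg2 : (n - i) * m = (m + 1) * n - μ.length - (k + m * i) := by
    obtain ⟨d, hd⟩ : ∃ d, n = i + d := ⟨n - i, by omega⟩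
    have e1 : (m + 1) * n = m * i + d * m + i + d := by rw [hd]; ring
    have e2 : n - i = d := by omega
    rw [hμ, e1, e2]
    omega
  rw [oddShift_plethysm, coeff_twistedSum_schur _ _ (hik.trans hk), Finset.mul_sum, hall_sum_left,
    Finset.sum_comm]
  refine Finset.sum_congr rfl fun β _ => ?_
  rw [Finset.mul_sum, hall_sum_left]
  simp only [skewPlethysmCoeff_oneRow_zero _ _ hdeg1, skewPlethysmCoeff_eq _ _ _ _ _ hdeg2,
    schur_oneRow, Finset.mul_sum]
  rw [Finset.sum_comm]
  refine Finset.sum_congr rfl fun η _ => ?_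
  let F : Lambda →ₗ[ℚ] ℚ :=
    hallForm (schur μ.removeColumn) ∘ₗ LinearMap.mulLeft ℚ (plethysm (schur η) (h m))
  have hF : ∀ x, F x = hall (plethysm (schur η) (h m) * x) (schur μ.removeColumn) := fun x =>
    hall_comm _ _
  have hhom : IsHomog (plethysm (schur β.conjugate) (h (m + 1)) * h (k - i)) (k + m * i) := by
    have := ((isHomog_schur β.conjugate).plethysm (isHomog_h (m + 1))).mul (isHomog_h (k - i))
    have e : i * (m + 1) + (k - i) = k + m * i := by omega
    rwa [e] at this
  rw [mul_smul_comm, hall_smul_left, plethysmHom_apply, plethysmHom_apply]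
  have hcomm : h (k - i) * (plethysm (schur β.conjugate) (h (m + 1)) * plethysm (schur η) (h m)) =
      plethysm (schur η) (h m) * (plethysm (schur β.conjugate) (h (m + 1)) * h (k - i)) := by ring
  rw [hcomm, ← hF, ← sum_hall_mul_hall hhom F, Finset.mul_sum]
  refine Finset.sum_congr rfl fun α _ => ?_
  rw [hF]
  ring

end SymFun

end

theorem theoremA (n m k : ℕ) (hm : 1 ≤ m) (hk : k < n)
    (lam : Nat.Partition n) (μ : Nat.Partition (m * n)) (hμ : μ.length = n - k) :
    SymFun.plethysmCoeff μ lam.conjugate (SymFun.oneRow m) =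
      ∑ i ∈ Finset.range (k + 1), (-1 : ℚ) ^ (k + i) *
        ∑ α : Nat.Partition (k + (m - 1) * i), ∑ β : Nat.Partition i,
          SymFun.skewPlethysmCoeff α (SymFun.oneRow (k - i))
              β.conjugate (SymFun.oneRow 0) (SymFun.oneRow m) *
            SymFun.skewPlethysmCoeff μ.removeColumn α lam β (SymFun.oneRow (m - 1)) := by
  obtain ⟨m, rfl⟩ : ∃ m', m = m' + 1 := ⟨m - 1, by omega⟩
  rw [Nat.add_sub_cancel, SymFun.plethysmCoeff_eq_sum_oddShift hk.le _ _ hμ]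
  refine Finset.sum_congr rfl fun i hi => ?_
  have hik : i ≤ k := Nat.lt_succ_iff.1 (Finset.mem_range.1 hi)
  rw [SymFun.sum_skewPlethysmCoeff_mul hik hk.le lam μ hμ]
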